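/- A \emph{graph} is finite, nonempty, connected and loopless, possibly with parallel edges; its genus is $g=|E(G)|-|V(G)|+1$. A \emph{divisor} on $G$ is a function $D:V(G)\to\mathbb Z$, its degree is $\deg D=\sum_x D(x)$, and $\sim$ is the equivalence generated by chip-firing moves (a move at $x$ sends one chip along each edge at $x$). The \emph{rank} $r(D)$ is the largest integer $s\ge -1$ such that $D-E$ is equivalent to an effective divisor for every effective divisor $E$ of degree $s$. The graph $G$ is \emph{Brill--Noether general} if $\rho(g,r,d)=g-(r+1)(g-d+r)\ge 0$ whenever $r\ge 0$, $d$ are integers for which some divisor $D$ has $\deg D=d$ and $r(D)\ge r$. Let $u,v$ be vertices of $G$ and put $\Delta(D)=r(D)-r(D-u)-r(D-v)+r(D-u-v)$. A divisor $D$ is \emph{submodular} if $\Delta(D+au+bv)\ge 0$ for all $a,b\in\mathbb Z$. Its \emph{transmission permutation}, which exists if and only if $D$ is submodular, is the unique bijection $\tau_D:\mathbb Z\to\mathbb Z$ such that, for all $a,b\in\mathbb Z$, $\Delta(D+au-bv)$ equals $1$ if $\tau_D(b)=a$ and $0$ otherwise. An \emph{inversion} of $\tau$ is a pair $(a,b)$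 with $a<b$, $\tau(a)>\tau(b)$; two inversions $(a,b),(a',b')$ are $k$-equivalent if $a-a'=b-b'\in k\mathbb Z$; $\operatorname{inv}_k(\tau)$ is the number of $k$-equivalence classes of inversions. For an integer $k\geq 1$, $(G,u,v)$ has \emph{$k$-general transmission} if $ku\sim kv$, every divisor $D$ is submodular, and $\operatorname{inv}_k(\tau_D)\le g$ for every $D$. \textbf{Proposition.} If a twice-marked graph $(G,u,v)$ of genus $g$ has $k$-general transmission and $k\ge \frac12 g+1$, then $G$ is Brill--Noether general. This bound is sharp: for all integers $g\ge 0$ and $k\ge 2$ with $k<\frac12 g+1$ there is a twice-marked graph $(G,u,v)$ of genus $g$ which has $k$-general transmission and for which $G$ is not Brill--Noether general. -/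

import Mathlib

namespace ChipFiring

universe u v

/-- The standing convention on graphs: finite, nonempty and connected, without loops;
parallel edges are allowed. -/
structure IsFiniteConnectedLoopless {α : Type u} {β : Type v} (G : Graph α β) : Prop where
  finite_vertexSet : G.vertexSet.Finite
  finite_edgeSet : G.edgeSet.Finite
  loopless : G.Loopless
  connected : G.toSimpleGraph.Connected

/-- The genus `|E(G)| - |V(G)| + 1`. For a connected graph `|V(G)| ≤ |E(G)| + 1`, so the
subtraction of natural numbers is exact. -/
noncomputable def genus {α : Type u} {β : Type v} (G : Graph α β) : ℕ :=
  G.edgeSet.ncard + 1 - G.vertexSet.ncard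

/-- The number of edges joining `x` and `y`. -/
noncomputable def edgeMult {α : Type u} {β : Type v} (G : Graph α β) (x y : α) : ℕ :=
  {e | G.IsLink e x y}.ncard

/-- Divisors (chip configurations) on `G`: integer-valued functions on the vertices. -/
abbrev Divisor {α : Type u} {β : Type v} (G : Graph α β) : Type u := G.vertexSet → ℤ

/-- The divisor consisting of one chip at the vertex `w`. -/
noncomputable def chip {α : Type u} {β : Type v} {G : Graph α β} (w : G.vertexSet) : Divisor G :=
  open scoped Classical in Pi.single w 1

/-- The degree of a divisor: its total number of chips. -/
noncomputable def deg {α : Type u} {β : Type v} {G : Graph α β} (D : Divisor G) : ℤ :=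
  ∑ᶠ x, D x

/-- The divisor by which a configuration changes when every vertex `x` is fired `f x` times:
each firing of `x` moves one chip along every edge at `x` to the other end of that edge. -/
noncomputable def firing {α : Type u} {β : Type v} {G : Graph α β} (f : G.vertexSet → ℤ) :
    Divisor G :=
  fun x => ∑ᶠ y : G.vertexSet, (edgeMult G x y : ℤ) * (f y - f x)

/-- Linear equivalence: `D'` is obtained from `D` by chip-firing moves and their inverses. -/
def LinEquiv {α : Type u} {β : Type v} {G : Graph α β} (D D' : Divisor G) : Prop :=
  ∃ f : G.vertexSet → ℤ, D' = D + firing f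

/-- `D` is linearly equivalent to an effective divisor. -/
def IsEquivEffective {α : Type u} {β : Type v} {G : Graph α β} (D : Divisor G) : Prop :=
  ∃ D' : Divisor G, LinEquiv D D' ∧ 0 ≤ D'

/-- The Baker--Norine rank: the largest integer `s ≥ -1` such that `D - E` is equivalent to an
effective divisor for every effective divisor `E` of degree `s`. The value `s = -1` satisfies the
condition vacuously and, on a nonempty finite graph, no `s > max (deg D) (-1)` satisfies it, so the
supremum is a maximum. -/
noncomputable def rank {α : Type u} {β : Type v} {G : Graph α β} (D : Divisor G) : ℤ :=
  sSup {s : ℤ | -1 ≤ s ∧ ∀ E : Divisor G, 0 ≤ E → deg E = s → IsEquivEffective (D - E)}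

/-- The divisor census: the pairs `(d, r)`, `r ≥ 0`, for which some divisor has degree `d` and rank
at least `r`. -/
def divisorCensus {α : Type u} {β : Type v} (G : Graph α β) : Set (ℤ × ℤ) :=
  {p | 0 ≤ p.2 ∧ ∃ D : Divisor G, deg D = p.1 ∧ p.2 ≤ rank D}

/-- The Brill--Noether number `ρ(g, r, d)`. -/
def brillNoetherNumber (g r d : ℤ) : ℤ := g - (r + 1) * (g - d + r)

/-- Brill--Noether general (unmarked) graphs. -/
def IsBrillNoetherGeneral {α : Type u} {β : Type v} (G : Graph α β) : Prop :=
  ∀ d r : ℤ, (d, r) ∈ divisorCensus G → 0 ≤ brillNoetherNumber (genus G) r d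

/-- `Δ(D) = r(D) - r(D - u) - r(D - v) + r(D - u - v)`. -/
noncomputable def rankDelta {α : Type u} {β : Type v} {G : Graph α β} (u v : G.vertexSet)
    (D : Divisor G) : ℤ :=
  rank D - rank (D - chip u) - rank (D - chip v) + rank (D - chip u - chip v)

/-- `D` is submodular with respect to `u, v`: `Δ ≥ 0` on all twists `D + a u + b v`. -/
def IsSubmodular {α : Type u} {β : Type v} {G : Graph α β} (u v : G.vertexSet)
    (D : Divisor G) : Prop :=
  ∀ a b : ℤ, 0 ≤ rankDelta u v (D + a • chip u + b • chip v)

/-- `τ` is the transmission permutation of `D`: the bijection `ℤ → ℤ` such that for all `a, b`,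
`Δ(D + a u - b v)` is `1` if `τ b = a` and `0` otherwise. There is at most one such `τ`. -/
def IsTransmissionPerm {α : Type u} {β : Type v} {G : Graph α β} (u v : G.vertexSet)
    (D : Divisor G) (τ : Equiv.Perm ℤ) : Prop :=
  ∀ a b : ℤ, rankDelta u v (D + a • chip u - b • chip v) = if τ b = a then 1 else 0

/-- The inversions of `τ`: pairs `(a, b)` with `a < b` and `τ a > τ b`. -/
abbrev Inversion (τ : Equiv.Perm ℤ) : Type :=
  {p : ℤ × ℤ // p.1 < p.2 ∧ τ p.2 < τ p.1}

/-- `k`-equivalence of inversions: `(a, b)` and `(a', b')` are `k`-equivalent if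
`a - a' = b - b'` and this difference is divisible by `k`. -/
def kEquiv (k : ℕ) (τ : Equiv.Perm ℤ) : Setoid (Inversion τ) where
  r p q := p.1.1 - q.1.1 = p.1.2 - q.1.2 ∧ (k : ℤ) ∣ p.1.1 - q.1.1
  iseqv :=
    { refl := fun p => by simp
      symm := fun {p q} h => by
        refine ⟨by linarith [h.1], ?_⟩
        have := (dvd_neg (α := ℤ)).2 h.2
        simpa using this
      trans := fun {p q s} h h' => by
        refine ⟨by linarith [h.1, h'.1], ?_⟩
        have := dvd_add h.2 h'.2
        simpa using this }

/-- `inv_k(τ)`: the number of `k`-equivalence classes of inversions of `τ`, possibly infinite. -/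
noncomputable def invCount (k : ℕ) (τ : Equiv.Perm ℤ) : ℕ∞ :=
  ENat.card (Quotient (kEquiv k τ))

/-- `(G, u, v)` has `k`-general transmission: `k` is positive, `k u ∼ k v`, every divisor `D` is
submodular, and its transmission permutation `τ` satisfies `inv_k(τ) ≤ g`. -/
def HasGeneralTransmission {α : Type u} {β : Type v} {G : Graph α β} (u v : G.vertexSet)
    (k : ℕ) : Prop :=
  0 < k ∧ LinEquiv (k • chip u) (k • chip v) ∧
    ∀ D : Divisor G, IsSubmodular u v D ∧
      ∀ τ : Equiv.Perm ℤ, IsTransmissionPerm u v D τ → invCount k τ ≤ (genus G : ℕ∞)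

end ChipFiring

open ChipFiring

/-! Bound. For a divisor `D` of degree `d`, the function `s a b = r(D + au - bv) + 1` is submodular
with unit steps, and `ku ∼ kv` makes it invariant under `(a, b) ↦ (a + k, b + k)`. Hence it counts
`n ≥ b` with `τ n ≤ a` for a permutation `τ` commuting with translation by `k`
(`exists_perm_of_submodular`). At the origin, `r(D) + 1` is the number of `n ≥ 0` with `τ n ≤ 0`,
and `r(D) ≤ deg D - g` in large degree shows that at least `g - d + r(D)` integers `n < 0` have `τ n
> 0`. Every pair from these two sets is an inversion. If the pairs are pairwise inequivalent, then
`(r + 1)(g - d + r) ≤ inv_k(τ) ≤ g`. If two of them are equivalent, some pair is inverted by more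
than `k` in both position and value, and every residue class then contributes to the inversions:
there are at least `2k - 1 > g` classes (`two_mul_sub_one_le_invCount`), a contradiction.

Sharpness. Take a chain of `g` cycles of length `k`, consecutive ones sharing a vertex, with the
attaching vertices of each cycle adjacent on it. Its Picard group is `ℤ × (ℤ/k)^g`, where
effectivity and rank are computed recursively cycle by cycle. Gluing on a cycle changes the
permutation by a shift and by sorting into descending order the values at `n, n + 1`, for `n` in one
residue class mod `k`. This creates at most one new inversion class, so `inv_k ≤ g`
(`exists_chain_perm`). On the other hand `ku` has degree `k` and rank at least `1`, while `ρ(g, 1,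
k) = 2k - 2 - g` is negative when `k < g/2 + 1`. -/

namespace ChipFiring

/-! ### Divisors, linear equivalence and the Baker–Norine rank. -/

section Basics

variable {α : Type*} {β : Type*} {G : Graph α β}

lemma edgeMult_comm (x y : α) : edgeMult G x y = edgeMult G y x := by
  simp only [edgeMult, Graph.isLink_comm (x := x)]

lemma deg_eq_sum [Fintype G.vertexSet] (D : Divisor G) : deg D = ∑ x, D x :=
  finsum_eq_sum_of_fintype _

lemma firing_apply [Fintype G.vertexSet] (f : G.vertexSet → ℤ) (x : G.vertexSet) :
    firing f x = ∑ y : G.vertexSet, (edgeMult G x y : ℤ) * (f y - f x) :=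
  finsum_eq_sum_of_fintype _

lemma firing_add [Finite G.vertexSet] (f h : G.vertexSet → ℤ) :
    firing (f + h) = firing f + firing h := by
  have := Fintype.ofFinite G.vertexSet
  ext x
  simp only [firing_apply, Pi.add_apply, ← Finset.sum_add_distrib]
  exact Finset.sum_congr rfl fun y _ => by ring

/-- Firing as a homomorphism from firing scripts to divisors. -/
noncomputable def firingHom (G : Graph α β) [Finite G.vertexSet] :
    (G.vertexSet → ℤ) →+ Divisor G :=
  AddMonoidHom.mk' firing firing_add

lemma firing_zero [Finite G.vertexSet] : firing (0 : G.vertexSet → ℤ) = 0 :=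
  (firingHom G).map_zero

lemma firing_neg [Finite G.vertexSet] (f : G.vertexSet → ℤ) : firing (-f) = -firing f :=
  (firingHom G).map_neg f

/-- The pairing of a firing with a function on the vertices. -/
lemma sum_firing_mul [Fintype G.vertexSet] (f c : G.vertexSet → ℤ) :
    ∑ x, firing f x * c x = ∑ x, f x * firing c x := by
  simp only [firing_apply, Finset.sum_mul, Finset.mul_sum]
  have h1 : ∑ x : G.vertexSet, ∑ y : G.vertexSet, (edgeMult G x y : ℤ) * (f y * c x) =
      ∑ x : G.vertexSet, ∑ y : G.vertexSet, (edgeMult G x y : ℤ) * (f x * c y) := by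
    rw [Finset.sum_comm]
    exact Finset.sum_congr rfl fun x _ => Finset.sum_congr rfl fun y _ => by
      rw [edgeMult_comm]
  have h2 : ∀ f c : G.vertexSet → ℤ, ∑ x : G.vertexSet, ∑ y : G.vertexSet,
      (edgeMult G x y : ℤ) * (f y - f x) * c x =
      ∑ x : G.vertexSet, ∑ y : G.vertexSet, (edgeMult G x y : ℤ) * (f y * c x) -
      ∑ x : G.vertexSet, ∑ y : G.vertexSet, (edgeMult G x y : ℤ) * (f x * c x) := by
    intro f c
    simp only [← Finset.sum_sub_distrib]
    exact Finset.sum_congr rfl fun x _ => Finset.sum_congr rfl fun y _ => by ring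
  rw [h2, h1]
  simp only [← Finset.sum_sub_distrib]
  exact Finset.sum_congr rfl fun x _ => Finset.sum_congr rfl fun y _ => by ring

lemma firing_const (c : ℤ) : firing (fun _ : G.vertexSet => c) = 0 := by
  ext x
  simp [firing]

lemma deg_firing [Finite G.vertexSet] (f : G.vertexSet → ℤ) : deg (firing f) = 0 := by
  have := Fintype.ofFinite G.vertexSet
  have h := sum_firing_mul f (fun _ => 1)
  rw [deg_eq_sum]
  simpa [firing_const] using h

lemma deg_add [Finite G.vertexSet] (D E : Divisor G) : deg (D + E) = deg D + deg E := by
  have := Fintype.ofFinite G.vertexSet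
  simp [deg_eq_sum, Finset.sum_add_distrib]

lemma deg_sub [Finite G.vertexSet] (D E : Divisor G) : deg (D - E) = deg D - deg E := by
  have := Fintype.ofFinite G.vertexSet
  simp [deg_eq_sum, Finset.sum_sub_distrib]

lemma deg_zsmul [Finite G.vertexSet] (n : ℤ) (D : Divisor G) : deg (n • D) = n * deg D := by
  have := Fintype.ofFinite G.vertexSet
  simp [deg_eq_sum, Finset.mul_sum]

lemma deg_chip [Finite G.vertexSet] (w : G.vertexSet) : deg (chip w) = 1 := by
  classical
  have := Fintype.ofFinite G.vertexSet
  simp [deg_eq_sum, chip, Pi.single_apply]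

lemma deg_nonneg [Finite G.vertexSet] {D : Divisor G} (hD : 0 ≤ D) : 0 ≤ deg D := by
  have := Fintype.ofFinite G.vertexSet
  rw [deg_eq_sum]
  exact Finset.sum_nonneg fun x _ => hD x

lemma chip_nonneg (w : G.vertexSet) : 0 ≤ (chip w : Divisor G) := by
  classical
  intro x
  simp only [chip, Pi.single_apply, Pi.zero_apply]
  split_ifs <;> simp

lemma isEquivEffective_iff (D : Divisor G) :
    IsEquivEffective D ↔ ∃ f : G.vertexSet → ℤ, 0 ≤ D + firing f :=
  ⟨fun ⟨_, ⟨f, hf⟩, h⟩ => ⟨f, hf ▸ h⟩, fun ⟨f, h⟩ => ⟨_, ⟨f, rfl⟩, h⟩⟩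

lemma IsEquivEffective.add {D E : Divisor G} (h : IsEquivEffective D) (hE : 0 ≤ E) :
    IsEquivEffective (D + E) := by
  rw [isEquivEffective_iff] at h ⊢
  obtain ⟨f, hf⟩ := h
  exact ⟨f, by rw [add_right_comm]; exact add_nonneg hf hE⟩

lemma IsEquivEffective.deg_nonneg [Finite G.vertexSet] {D : Divisor G}
    (h : IsEquivEffective D) : 0 ≤ deg D := by
  rw [isEquivEffective_iff] at h
  obtain ⟨f, hf⟩ := h
  have := ChipFiring.deg_nonneg hf
  rwa [deg_add, deg_firing, add_zero] at this

lemma LinEquiv.refl [Finite G.vertexSet] (D : Divisor G) : LinEquiv D D :=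
  ⟨0, by rw [firing_zero, add_zero]⟩

lemma LinEquiv.symm [Finite G.vertexSet] {D D' : Divisor G} (h : LinEquiv D D') :
    LinEquiv D' D := by
  obtain ⟨f, rfl⟩ := h
  exact ⟨-f, by rw [firing_neg]; abel⟩

lemma LinEquiv.add [Finite G.vertexSet] {D D' E E' : Divisor G} (h : LinEquiv D D')
    (h' : LinEquiv E E') : LinEquiv (D + E) (D' + E') := by
  obtain ⟨f, rfl⟩ := h
  obtain ⟨f', rfl⟩ := h'
  exact ⟨f + f', by rw [firing_add]; abel⟩

lemma LinEquiv.isEquivEffective [Finite G.vertexSet] {D D' : Divisor G} (h : LinEquiv D D')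
    (hD : IsEquivEffective D) : IsEquivEffective D' := by
  rw [isEquivEffective_iff] at hD ⊢
  obtain ⟨f, hf⟩ := hD
  obtain ⟨f', rfl⟩ := h.symm
  exact ⟨f' + f, by rwa [firing_add, ← add_assoc]⟩

lemma rank_congr [Finite G.vertexSet] {D D' : Divisor G} (h : LinEquiv D D') :
    rank D = rank D' := by
  have key : ∀ E : Divisor G, IsEquivEffective (D - E) ↔ IsEquivEffective (D' - E) := fun E => by
    simp only [sub_eq_add_neg]
    exact ⟨(h.add (.refl _)).isEquivEffective, (h.symm.add (.refl _)).isEquivEffective⟩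
  simp only [rank, key]

lemma exists_eq_chip_add [Finite G.vertexSet] {E : Divisor G} (hE : 0 ≤ E) (hd : 0 < deg E) :
    ∃ (w : G.vertexSet) (E' : Divisor G), 0 ≤ E' ∧ E = chip w + E' := by
  classical
  have := Fintype.ofFinite G.vertexSet
  rw [deg_eq_sum] at hd
  obtain ⟨w, -, hw⟩ := Finset.exists_lt_of_sum_lt (s := Finset.univ) (f := 0) (g := E)
    (by simpa using hd)
  refine ⟨w, E - chip w, fun x => ?_, by abel⟩
  have := hE x
  simp only [chip, Pi.single_apply, Pi.zero_apply, Pi.sub_apply] at this hw ⊢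
  split_ifs with h
  · subst h; omega
  · simpa using this

variable [Finite G.vertexSet] [Nonempty G.vertexSet]

/-- The set defining the rank is bounded by the degree, so its supremum is attained. It is downward
closed because a smaller `E` can be padded with chips at a fixed vertex, which are given back
afterwards. -/
lemma le_rank_iff {s : ℤ} (hs : -1 ≤ s) (D : Divisor G) :
    s ≤ rank D ↔ ∀ E : Divisor G, 0 ≤ E → deg E = s → IsEquivEffective (D - E) := by
  obtain ⟨w⟩ := ‹Nonempty G.vertexSet›
  set S := {s : ℤ | -1 ≤ s ∧ ∀ E : Divisor G, 0 ≤ E → deg E = s → IsEquivEffective (D - E)}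
    with hS
  have hne : S.Nonempty := ⟨-1, le_rfl, fun E hE hd => by have := deg_nonneg hE; omega⟩
  have hbdd : BddAbove S := by
    refine ⟨max (deg D) (-1), fun s ⟨h1, h2⟩ => ?_⟩
    rcases lt_or_ge s 0 with h | h
    · exact le_max_of_le_right (by omega)
    · have := (h2 (s • chip w) (zsmul_nonneg (chip_nonneg w) h)
        (by rw [deg_zsmul, deg_chip, mul_one])).deg_nonneg
      rw [deg_sub, deg_zsmul, deg_chip] at this
      exact le_max_of_le_left (by omega)
  have hmem : rank D ∈ S := Int.csSup_mem hne hbdd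
  refine ⟨fun h E hE hd => ?_, fun h => le_csSup hbdd ⟨hs, h⟩⟩
  have h0 : 0 ≤ (rank D - s) • (chip w : Divisor G) :=
    zsmul_nonneg (chip_nonneg w) (by omega)
  have := (hmem.2 (E + (rank D - s) • chip w) (add_nonneg hE h0)
    (by rw [deg_add, deg_zsmul, deg_chip, hd]; ring)).add h0
  rwa [← sub_sub, sub_add_cancel] at this

lemma neg_one_le_rank (D : Divisor G) : -1 ≤ rank D :=
  (le_rank_iff le_rfl D).2 fun E hE hd => by have := deg_nonneg hE; omega

lemma zero_le_rank_iff (D : Divisor G) : 0 ≤ rank D ↔ IsEquivEffective D := by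
  have := Fintype.ofFinite G.vertexSet
  rw [le_rank_iff (by norm_num)]
  refine ⟨fun h => by simpa using h 0 le_rfl (by simp [deg_eq_sum]), fun h E hE hd => ?_⟩
  have hE0 : E = 0 := by
    rw [deg_eq_sum, Finset.sum_eq_zero_iff_of_nonneg fun x _ => hE x] at hd
    exact funext fun x => hd x (Finset.mem_univ x)
  rwa [hE0, sub_zero]

/-- An effective divisor of positive degree contains a chip, so the test divisors can be removed one
chip at a time. `ChainRankGE` copies this recursion. -/
lemma add_one_le_rank_iff {s : ℤ} (hs : 0 ≤ s) (D : Divisor G) :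
    s + 1 ≤ rank D ↔ ∀ w : G.vertexSet, s ≤ rank (D - chip w) := by
  simp only [le_rank_iff (show -1 ≤ s + 1 by omega), le_rank_iff (show -1 ≤ s by omega)]
  refine ⟨fun h w E hE hd => ?_, fun h E hE hd => ?_⟩
  · rw [sub_sub]
    exact h _ (add_nonneg (chip_nonneg w) hE) (by rw [deg_add, deg_chip, hd]; ring)
  · obtain ⟨w, E', hE', rfl⟩ := exists_eq_chip_add hE (by omega)
    rw [deg_add, deg_chip] at hd
    rw [← sub_sub]
    exact h w E' hE' (by omega)

lemma rank_sub_one_le (D : Divisor G) (w : G.vertexSet) :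
    rank D - 1 ≤ rank (D - chip w) := by
  rcases lt_or_ge (rank D) 1 with h | h
  · have := neg_one_le_rank (D - chip w); omega
  · exact (add_one_le_rank_iff (s := rank D - 1) (by omega) D).1 (by omega) w

lemma rank_add_le {D E : Divisor G} (hE : 0 ≤ E) : rank D ≤ rank (D + E) := by
  rw [le_rank_iff (neg_one_le_rank D)]
  intro F hF hd
  rw [add_sub_right_comm]
  exact ((le_rank_iff (neg_one_le_rank D) D).1 le_rfl F hF hd).add hE

lemma rank_sub_chip_le (D : Divisor G) (w : G.vertexSet) :
    rank (D - chip w) ≤ rank D := by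
  simpa using rank_add_le (D := D - chip w) (chip_nonneg w)

lemma rank_eq_neg_one {D : Divisor G} (h : deg D < 0) : rank D = -1 := by
  refine le_antisymm ?_ (neg_one_le_rank D)
  by_contra! hc
  have := ((zero_le_rank_iff D).1 (by omega)).deg_nonneg
  omega

end Basics

/-! ### Asymptotic Riemann–Roch inequalities. -/

section Riemann

variable {α : Type*} {β : Type*} {G : Graph α β}

lemma edgeMult_eq_sum (E : Finset β) (hE : ↑E = G.edgeSet) (x y : α) :
    edgeMult G x y = open scoped Classical in ∑ e ∈ E, if G.IsLink e x y then 1 else 0 := by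
  classical
  rw [edgeMult, Finset.sum_boole, Nat.cast_id, ← Set.ncard_coe_finset]
  congr 1
  ext e
  simp only [Set.mem_ofPred_eq, Finset.coe_filter]
  exact ⟨fun h => ⟨by rw [← Finset.mem_coe, hE]; exact h.edge_mem, h⟩, fun h => h.2⟩

/-- The divisor of the acyclic orientation induced by an ordering `o` of the vertices. -/
noncomputable def orderDivisor (o : G.vertexSet → ℕ) : Divisor G :=
  fun x => ∑ᶠ y : G.vertexSet, (if o y < o x then (edgeMult G x y : ℤ) else 0) - 1

/-- Among the vertices where the firing script is maximal, take the first one in the ordering. Its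
earlier neighbours have strictly smaller script values, so it loses at least one chip along each
incoming edge, and what remains there is at most `-1`. -/
lemma not_isEquivEffective_orderDivisor [Finite G.vertexSet] [Nonempty G.vertexSet]
    (o : G.vertexSet → ℕ) : ¬ IsEquivEffective (orderDivisor (G := G) o) := by
  classical
  have := Fintype.ofFinite G.vertexSet
  rw [isEquivEffective_iff]
  rintro ⟨f, hf⟩
  obtain ⟨z, hz⟩ := Finite.exists_max f
  obtain ⟨x, hx, hmin⟩ := Finset.exists_min_image
    (Finset.univ.filter fun x : G.vertexSet => f x = f z) o ⟨z, by simp⟩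
  simp only [Finset.mem_filter, Finset.mem_univ, true_and] at hx hmin
  have h := hf x
  simp only [Pi.zero_apply, Pi.add_apply, orderDivisor, firing_apply,
    finsum_eq_sum_of_fintype] at h
  have h2 : ∑ y : G.vertexSet, (if o y < o x then (edgeMult G x y : ℤ) else 0) +
      ∑ y : G.vertexSet, (edgeMult G x y : ℤ) * (f y - f x) ≤ 0 := by
    rw [← Finset.sum_add_distrib]
    refine Finset.sum_nonpos fun y _ => ?_
    have hm : (0 : ℤ) ≤ edgeMult G x y := Int.natCast_nonneg _
    have hy := hz y
    split_ifs with hlt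
    · have : f y ≠ f z := fun h => absurd (hmin y h) (by omega)
      nlinarith [show f y - f x ≤ -1 by omega]
    · nlinarith
  omega

/-- Each edge is counted exactly once, at the later of its two ends. -/
lemma deg_orderDivisor [Fintype G.vertexSet] (hE : G.edgeSet.Finite) (hl : G.Loopless)
    (o : G.vertexSet → ℕ) (ho : Function.Injective o) :
    deg (orderDivisor (G := G) o) = G.edgeSet.ncard - G.vertexSet.ncard := by
  classical
  have key : ∑ x : G.vertexSet, ∑ y : G.vertexSet,
      (if o y < o x then edgeMult G x y else 0) = G.edgeSet.ncard := by
    simp only [edgeMult_eq_sum hE.toFinset hE.coe_toFinset]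
    have h1 : ∀ x y : G.vertexSet,
        (if o y < o x then ∑ e ∈ hE.toFinset, (if G.IsLink e x y then 1 else 0) else 0) =
        ∑ e ∈ hE.toFinset, (if o y < o x ∧ G.IsLink e x y then 1 else 0) := by
      intro x y
      split_ifs with h <;> simp [h]
    simp only [h1]
    rw [Finset.sum_congr rfl fun x _ => Finset.sum_comm, Finset.sum_comm,
      Set.ncard_eq_toFinset_card _ hE, Finset.card_eq_sum_ones]
    refine Finset.sum_congr rfl fun e he => ?_
    rw [← Finset.sum_product', Finset.univ_product_univ]
    have hex : ∃ x y : G.vertexSet, G.IsLink e x y ∧ o y < o x := by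
      obtain ⟨x, y, h⟩ := G.exists_isLink_of_mem_edgeSet (hE.mem_toFinset.1 he)
      have hne : o ⟨x, h.left_mem⟩ ≠ o ⟨y, h.right_mem⟩ := fun h' =>
        h.ne (congrArg Subtype.val (ho h'))
      rcases lt_or_gt_of_ne hne with h' | h'
      · exact ⟨⟨y, h.right_mem⟩, ⟨x, h.left_mem⟩, h.symm, h'⟩
      · exact ⟨⟨x, h.left_mem⟩, ⟨y, h.right_mem⟩, h, h'⟩
    obtain ⟨x, y, h, hlt⟩ := hex
    rw [Finset.sum_eq_single (x, y)]
    · simp [h, hlt]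
    · rintro ⟨x', y'⟩ - hne
      rw [if_neg]
      rintro ⟨h1, h2⟩
      rcases h2.eq_and_eq_or_eq_and_eq h with ⟨h3, h4⟩ | ⟨h3, h4⟩
      · exact hne (Prod.ext (Subtype.ext h3) (Subtype.ext h4))
      · obtain rfl : x' = y := Subtype.ext h3
        obtain rfl : y' = x := Subtype.ext h4
        exact absurd h1 hlt.not_gt
    · simp
  rw [deg_eq_sum]
  simp only [orderDivisor, finsum_eq_sum_of_fintype, Finset.sum_sub_distrib]
  have hcard : Fintype.card G.vertexSet = G.vertexSet.ncard := by
    rw [← Nat.card_eq_fintype_card, Nat.card_coe_set_eq]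
  rw [← key, Finset.sum_const, Finset.card_univ, hcard]
  push_cast
  simp

lemma exists_not_isEquivEffective (hG : IsFiniteConnectedLoopless G) :
    ∃ D : Divisor G, deg D = (genus G : ℤ) - 1 ∧ ¬ IsEquivEffective D := by
  have hfin := hG.finite_vertexSet.to_subtype
  have := Fintype.ofFinite G.vertexSet
  have hne := hG.connected.nonempty
  obtain ⟨w⟩ := id hne
  rcases le_or_gt G.vertexSet.ncard (G.edgeSet.ncard + 1) with h | h
  · obtain ⟨n, ⟨e⟩⟩ := Finite.exists_equiv_fin G.vertexSet
    refine ⟨orderDivisor (Fin.val ∘ e), ?_, not_isEquivEffective_orderDivisor _⟩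
    rw [deg_orderDivisor hG.finite_edgeSet hG.loopless _
      (Fin.val_injective.comp e.injective), genus]
    omega
  -- In this branch the truncated subtraction gives genus `0`, and any divisor of degree `-1`
  -- serves. This avoids proving `|V| ≤ |E| + 1`.
  · refine ⟨(-1 : ℤ) • chip w, ?_, fun h => ?_⟩
    · rw [deg_zsmul, deg_chip, genus]; omega
    · have := h.deg_nonneg
      rw [deg_zsmul, deg_chip] at this; omega

/-- The real Laplacian, with the sign convention of `firing`. -/
noncomputable def laplacian (G : Graph α β) [Fintype G.vertexSet] :
    (G.vertexSet → ℝ) →ₗ[ℝ] (G.vertexSet → ℝ) where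
  toFun f x := ∑ y : G.vertexSet, (edgeMult G x y : ℝ) * (f y - f x)
  map_add' f h := by
    ext x
    simp only [Pi.add_apply, ← Finset.sum_add_distrib]
    exact Finset.sum_congr rfl fun y _ => by ring
  map_smul' c f := by
    ext x
    simp only [Pi.smul_apply, smul_eq_mul, RingHom.id_apply, Finset.mul_sum]
    exact Finset.sum_congr rfl fun y _ => by ring

lemma laplacian_apply [Fintype G.vertexSet] (f : G.vertexSet → ℝ) (x : G.vertexSet) :
    laplacian G f x = ∑ y : G.vertexSet, (edgeMult G x y : ℝ) * (f y - f x) := rfl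

lemma sum_laplacian [Fintype G.vertexSet] (f : G.vertexSet → ℝ) :
    ∑ x, laplacian G f x = 0 := by
  have h : ∑ x, laplacian G f x = - ∑ x, laplacian G f x := by
    simp only [laplacian_apply]
    nth_rewrite 1 [Finset.sum_comm]
    simp only [← Finset.sum_neg_distrib]
    exact Finset.sum_congr rfl fun x _ => Finset.sum_congr rfl fun y _ => by
      rw [edgeMult_comm]; ring
  linarith

/-- Maximum principle: at a maximum all terms of the Laplacian are nonpositive and sum to zero, so
the maximal value spreads to the neighbours and, by connectedness, everywhere. -/
lemma eq_of_laplacian_eq_zero (hG : IsFiniteConnectedLoopless G) [Fintype G.vertexSet]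
    {f : G.vertexSet → ℝ} (hf : laplacian G f = 0) (x y : G.vertexSet) : f x = f y := by
  have hne := hG.connected.nonempty
  obtain ⟨z, hz⟩ := Finite.exists_max f
  have step : ∀ x y : G.vertexSet, G.toSimpleGraph.Adj x y → f x = f z → f y = f z := by
    intro x y hadj hx
    have h0 := congrFun hf x
    rw [laplacian_apply, Pi.zero_apply, Finset.sum_eq_zero_iff_of_nonpos] at h0
    · have h1 := h0 y (Finset.mem_univ y)
      have hpos : 0 < edgeMult G x y := by
        obtain ⟨e, he⟩ := hadj.2
        exact (Set.ncard_pos (hG.finite_edgeSet.subset fun e h => Graph.IsLink.edge_mem h)).2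
          ⟨e, he⟩
      rcases mul_eq_zero.1 h1 with h2 | h2
      · exact absurd h2 (by positivity)
      · linarith
    · intro y _
      exact mul_nonpos_of_nonneg_of_nonpos (Nat.cast_nonneg _) (by linarith [hz y])
  have all : ∀ y, f y = f z := by
    intro y
    obtain ⟨p⟩ := hG.connected.preconnected z y
    have : ∀ {a b : G.vertexSet}, G.toSimpleGraph.Walk a b → f a = f z → f b = f z := by
      intro a b p
      induction p with
      | nil => exact id
      | cons h _ ih => exact fun ha => ih (step _ _ h ha)
    exact this p rfl
  rw [all x, all y]

/-- Every divisor of sufficiently large degree is equivalent to an effective one. -/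
lemma exists_forall_isEquivEffective (hG : IsFiniteConnectedLoopless G) :
    ∃ C : ℤ, ∀ D : Divisor G, C ≤ deg D → IsEquivEffective D := by
  have hfin := hG.finite_vertexSet.to_subtype
  have := Fintype.ofFinite G.vertexSet
  have hne := hG.connected.nonempty
  -- Subtracting the total sum kills the constants in the kernel of the Laplacian. Being injective,
  -- `M` is surjective, which yields a real script spreading the chips of `D` evenly.
  let M : (G.vertexSet → ℝ) →ₗ[ℝ] (G.vertexSet → ℝ) :=
    laplacian G - LinearMap.pi fun _ => ∑ x, LinearMap.proj x
  have hM : ∀ f x, M f x = laplacian G f x - ∑ y, f y := fun f x => by simp [M]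
  have hcard : (0 : ℝ) < Fintype.card G.vertexSet := by
    exact_mod_cast Fintype.card_pos
  have hinj : Function.Injective M := by
    rw [injective_iff_map_eq_zero]
    intro f hf
    have h1 : ∀ x, laplacian G f x = ∑ y, f y := fun x => by
      have := congrFun hf x; rw [hM, Pi.zero_apply] at this; linarith
    have h2 : ∑ y, f y = 0 := by
      have := sum_laplacian f
      simp only [h1, Finset.sum_const, Finset.card_univ, nsmul_eq_mul] at this
      exact (mul_eq_zero.1 this).resolve_left hcard.ne'
    have h3 := eq_of_laplacian_eq_zero hG (f := f) (funext fun x => by rw [h1, h2]; rfl)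
    ext x
    rw [Finset.sum_congr rfl fun y _ => h3 y x, Finset.sum_const, Finset.card_univ,
      nsmul_eq_mul] at h2
    exact (mul_eq_zero.1 h2).resolve_left hcard.ne'
  have hsurj := LinearMap.injective_iff_surjective.1 hinj
  set C : ℕ := ∑ x : G.vertexSet, ∑ y : G.vertexSet, edgeMult G x y with hC
  refine ⟨Fintype.card G.vertexSet * C, fun D hD => ?_⟩
  obtain ⟨f, hf⟩ := hsurj fun x => -(D x : ℝ)
  have h1 : ∀ x, (D x : ℝ) + laplacian G f x = ∑ y, f y := fun x => by
    have := congrFun hf x; rw [hM] at this; linarith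
  have h2 : (deg D : ℝ) = Fintype.card G.vertexSet * ∑ y, f y := by
    have := Finset.sum_congr (rfl : (Finset.univ : Finset G.vertexSet) = _) fun x _ => h1 x
    rw [Finset.sum_add_distrib, sum_laplacian, add_zero, Finset.sum_const, Finset.card_univ,
      nsmul_eq_mul] at this
    rw [deg_eq_sum]; push_cast; exact this
  have h3 : (C : ℝ) ≤ ∑ y, f y := by
    have : ((Fintype.card G.vertexSet * C : ℤ) : ℝ) ≤ deg D := by exact_mod_cast hD
    rw [h2] at this
    push_cast at this
    exact le_of_mul_le_mul_left this hcard
  rw [isEquivEffective_iff]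
  -- Rounding the real script down costs each vertex at most its number of edge ends, hence at most
  -- `C`, and every vertex holds at least `C` chips before rounding.
  refine ⟨fun x => ⌊f x⌋, fun x => ?_⟩
  have h4 : laplacian G f x - ((firing (fun x => ⌊f x⌋) x : ℤ) : ℝ) ≤ C := by
    rw [laplacian_apply, firing_apply]
    push_cast
    rw [← Finset.sum_sub_distrib]
    calc _ ≤ ∑ y : G.vertexSet, (edgeMult G x y : ℝ) := Finset.sum_le_sum fun y _ => by
            have a1 := Int.floor_le (f x)
            have a2 := Int.lt_floor_add_one (f y)
            have : (0 : ℝ) ≤ edgeMult G x y := Nat.cast_nonneg _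
            nlinarith
      _ = ((∑ y : G.vertexSet, edgeMult G x y : ℕ) : ℝ) := by push_cast; rfl
      _ ≤ C := by
            exact_mod_cast Finset.single_le_sum
              (f := fun x : G.vertexSet => ∑ y : G.vertexSet, edgeMult G x y)
              (fun _ _ => Nat.zero_le _) (Finset.mem_univ x)
  have h5 : (0 : ℝ) ≤ ((D x + firing (fun x => ⌊f x⌋) x : ℤ) : ℝ) := by
    push_cast; linarith [h1 x]
  exact_mod_cast h5

/-- Upper bound for the rank in large degree. -/
lemma exists_forall_rank_le (hG : IsFiniteConnectedLoopless G) :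
    ∃ C : ℤ, ∀ D : Divisor G, C ≤ deg D → rank D ≤ deg D - genus G := by
  have hfin := hG.finite_vertexSet.to_subtype
  have hne := hG.connected.nonempty
  obtain ⟨C, hC⟩ := exists_forall_isEquivEffective hG
  obtain ⟨N, hN, hN'⟩ := exists_not_isEquivEffective hG
  refine ⟨max (C + genus G - 1) (genus G - 1), fun D hD => ?_⟩
  by_contra! hlt
  have h1 : deg D - genus G + 1 ≤ rank D := hlt
  rw [le_rank_iff (by omega)] at h1
  -- `D - N` is equivalent to an effective `E` of degree `deg D - g + 1`. Were the rank that large,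
  -- `D - E ∼ N` would be equivalent to an effective divisor.
  obtain ⟨f, hf⟩ := (isEquivEffective_iff _).1 (hC (D - N) (by rw [deg_sub]; omega))
  have h2 := h1 _ hf (by rw [deg_add, deg_firing, deg_sub, hN]; ring)
  refine hN' (LinEquiv.isEquivEffective ⟨f, ?_⟩ h2)
  abel

/-- Lower bound for the rank. -/
lemma exists_forall_le_rank (hG : IsFiniteConnectedLoopless G) :
    ∃ C : ℤ, ∀ D : Divisor G, deg D - C ≤ rank D := by
  have hfin := hG.finite_vertexSet.to_subtype
  have hne := hG.connected.nonempty
  obtain ⟨C, hC⟩ := exists_forall_isEquivEffective hG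
  refine ⟨C, fun D => ?_⟩
  rcases lt_or_ge (deg D - C) (-1) with h | h
  · exact h.le.trans (neg_one_le_rank D)
  · rw [le_rank_iff h]
    exact fun E _ hd => hC _ (by rw [deg_sub, hd]; omega)

end Riemann

/-! ### Affine permutations, their rank functions and their inversions. -/

section AffinePermutations

/-- By submodularity the drop from `b` to `b + 1` is monotone in `a`, and it vanishes for very
negative `a`. If it never became `1`, periodicity would let `s` grow by at most `k - 1` whenever `a`
grows by `k`, against the linear growth of slope one. -/
lemma exists_threshold {s : ℤ → ℤ → ℤ} {k : ℕ} (hk : 0 < k) {L : ℤ}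
    (hb : ∀ a b, s a b - s a (b + 1) = 0 ∨ s a b - s a (b + 1) = 1)
    (hΔ : ∀ a b, 0 ≤ s a b - s (a - 1) b - s a (b + 1) + s (a - 1) (b + 1))
    (hper : ∀ a b, s (a + k) (b + k) = s a b)
    (hzero : ∀ a b, a - b < -L → s a b = 0)
    (hgrow : ∀ a b, a - b - L ≤ s a b) (b : ℤ) :
    ∃ t, ∀ a, s a b - s a (b + 1) = if t ≤ a then 1 else 0 := by
  have hmono : Monotone fun a => s a b - s a (b + 1) := by
    refine monotone_int_of_le_succ fun a => ?_
    have := hΔ (a + 1) b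
    rw [add_sub_cancel_right] at this
    linarith
  have hex : ∃ a, s a b - s a (b + 1) = 1 := by
    by_contra! hne
    have h0 : ∀ a, s a b - s a (b + 1) = 0 := fun a => (hb a b).resolve_right (hne a)
    have h1 : ∀ a (j : ℕ), s a (b + 1) - s a (b + 1 + j) ≤ j := by
      intro a j
      induction j with
      | zero => simp
      | succ j ih =>
        have := hb a (b + 1 + j)
        push_cast
        rw [← add_assoc]
        omega
    have h2 : ∀ a, s (a + k) b ≤ s a b + (k - 1) := by
      intro a
      have e1 := h0 (a + k)
      have e2 := h1 (a + k) (k - 1)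
      rw [Nat.cast_sub hk, show b + 1 + ((k : ℤ) - (1 : ℕ)) = b + k by push_cast; ring, hper] at e2
      push_cast at e2
      omega
    have h3 : ∀ m : ℕ, s (b - L - 1 + m * k) b ≤ m * (k - 1) := by
      intro m
      induction m with
      | zero => simp [hzero (b - L - 1) b (by omega)]
      | succ m ih =>
        have := h2 (b - L - 1 + m * k)
        push_cast
        rw [show b - L - 1 + ((m : ℤ) + 1) * k = b - L - 1 + m * k + k by ring]
        linarith
    -- After `m` periods the two bounds read `m * k - 2 * L - 1 ≤ m * (k - 1)`, so any `m > 2 * L +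
    -- 1` is contradictory.
    have h4 := h3 (2 * L + 2).toNat
    have h5 := hgrow (b - L - 1 + (2 * L + 2).toNat * k) b
    have h6 := Int.self_le_toNat (2 * L + 2)
    nlinarith
  obtain ⟨t, ht, hmin⟩ := Int.exists_least_of_bdd (P := fun a => s a b - s a (b + 1) = 1)
    ⟨b - L, fun a ha => by
      by_contra! hlt
      have e1 := hzero a b (by omega)
      have e2 := hzero a (b + 1) (by omega)
      omega⟩ hex
  refine ⟨t, fun a => ?_⟩
  split_ifs with h
  · have h1 : s t b - s t (b + 1) ≤ s a b - s a (b + 1) := hmono h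
    have := hb a b
    omega
  · exact (hb a b).resolve_right fun h' => h (hmin a h')

/-- A submodular, `k`-periodic rank function of linear growth is the rank function of an
affine permutation. -/
lemma exists_perm_of_submodular {s : ℤ → ℤ → ℤ} {k : ℕ} (hk : 0 < k) {L : ℤ}
    (ha : ∀ a b, s a b - s (a - 1) b = 0 ∨ s a b - s (a - 1) b = 1)
    (hb : ∀ a b, s a b - s a (b + 1) = 0 ∨ s a b - s a (b + 1) = 1)
    (hΔ : ∀ a b, 0 ≤ s a b - s (a - 1) b - s a (b + 1) + s (a - 1) (b + 1))
    (hper : ∀ a b, s (a + k) (b + k) = s a b)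
    (hzero : ∀ a b, a - b < -L → s a b = 0)
    (hgrow : ∀ a b, a - b - L ≤ s a b) :
    ∃ τ : Equiv.Perm ℤ, (∀ n, τ (n + k) = τ n + k) ∧
      ∀ a b, s a b - s a (b + 1) = if τ b ≤ a then 1 else 0 := by
  choose t ht using exists_threshold hk hb hΔ hper hzero hgrow
  -- The hypotheses are symmetric under `(a, b) ↦ (-b, -a)`. The thresholds in the other direction
  -- give the inverse of `t`, since both locate the places where the mixed second difference is `1`.
  have hdual := exists_threshold (s := fun a b => s (-b) (-a)) hk (L := L)
    (fun a b => by
      have := ha (-b) (-a)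
      rwa [show -b - 1 = -(b + 1) by ring] at this)
    (fun a b => by
      have := hΔ (-b) (-a)
      rw [show -b - 1 = -(b + 1) by ring, show -a + 1 = -(a - 1) by ring] at this
      linarith)
    (fun a b => by
      have := hper (-(b + k)) (-(a + k))
      rw [show -(b + (k : ℤ)) + k = -b by ring, show -(a + (k : ℤ)) + k = -a by ring] at this
      exact this.symm)
    (fun a b h => hzero _ _ (by omega))
    (fun a b => by
      have := hgrow (-b) (-a)
      linarith)
  choose t' ht' using hdual
  have hiff : ∀ a b, t b = a ↔ -t' (-a) = b := by
    intro a b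
    have e1 := ht b a
    have e2 := ht b (a - 1)
    have e3 := ht' (-a) (-b)
    have e4 := ht' (-a) (-(b + 1))
    simp only [show -(-a + 1) = a - 1 by ring, neg_neg] at e3 e4
    have e5 : ((if t b ≤ a then 1 else 0) - (if t b ≤ a - 1 then 1 else 0) : ℤ) =
        (if t' (-a) ≤ -b then 1 else 0) - (if t' (-a) ≤ -(b + 1) then 1 else 0) := by
      rw [← e1, ← e2, ← e3, ← e4]; ring
    split_ifs at e5 <;> omega
  refine ⟨⟨t, fun a => -t' (-a), fun b => (hiff _ _).1 rfl, fun a => (hiff _ _).2 rfl⟩, ?_,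
    fun a b => ht b a⟩
  intro n
  have h : ∀ a, t n ≤ a ↔ t (n + k) ≤ a + k := by
    intro a
    have e1 := ht n a
    have e2 := ht (n + k) (a + k)
    rw [add_right_comm, hper, hper, e1] at e2
    constructor <;> intro h' <;> split_ifs at e2 <;> omega
  have e1 := (h (t n)).1 le_rfl
  have e2 := (h (t (n + k) - k)).2 (by omega)
  change t (n + k) = t n + k
  omega

/-- The invariants of a `k`-equivalence class of pairs: the residues and the difference. -/
def pairClass (k : ℕ) (p : ℤ × ℤ) : ZMod k × ZMod k × ℤ := (p.1, p.2, p.2 - p.1)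

lemma pairClass_eq_iff {k : ℕ} {p q : ℤ × ℤ} :
    pairClass k p = pairClass k q ↔ p.1 - q.1 = p.2 - q.2 ∧ (k : ℤ) ∣ p.1 - q.1 := by
  simp only [pairClass, Prod.mk.injEq, ← sub_eq_zero (b := ((q.1 : ℤ) : ZMod k)),
    ← sub_eq_zero (b := ((q.2 : ℤ) : ZMod k)), ← Int.cast_sub, ZMod.intCast_zmod_eq_zero_iff_dvd]
  constructor
  · rintro ⟨h1, -, h3⟩
    exact ⟨by omega, h1⟩
  · rintro ⟨h1, h2⟩
    exact ⟨h2, h1 ▸ h2, by omega⟩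

lemma card_le_invCount {k : ℕ} {τ : Equiv.Perm ℤ} (F : Finset (ZMod k × ZMod k × ℤ))
    (hF : ∀ t ∈ F, ∃ p : ℤ × ℤ, p.1 < p.2 ∧ τ p.2 < τ p.1 ∧ pairClass k p = t) :
    (F.card : ℕ∞) ≤ invCount k τ := by
  choose! p h1 h2 h3 using hF
  have hcard : (F.card : ℕ∞) = ENat.card F := by simp
  rw [hcard]
  refine ENat.card_le_card_of_injective
    (f := fun t : F => Quotient.mk (kEquiv k τ) ⟨p t, h1 t t.2, h2 t t.2⟩) ?_
  intro t t' h
  have h4 : pairClass k (p t) = pairClass k (p t') := pairClass_eq_iff.2 (Quotient.exact h)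
  rw [h3 t t.2, h3 t' t'.2] at h4
  exact Subtype.ext h4

lemma apply_add_mul {k : ℕ} {τ : Equiv.Perm ℤ} (hτ : ∀ n, τ (n + k) = τ n + k) (n m : ℤ) :
    τ (n + m * k) = τ n + m * k := by
  induction m using Int.induction_on with
  | zero => simp
  | succ i ih => rw [add_mul, one_mul, ← add_assoc, hτ, ih, add_assoc]
  | pred i ih =>
    have := hτ (n + (-i - 1) * k)
    rw [show n + (-(i : ℤ) - 1) * k + k = n + -i * k by ring, ih] at this
    linarith

/-- A pair that is inverted with a margin larger than `k` in both position and value forces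
many inversions. -/
lemma two_mul_sub_one_le_invCount {k : ℕ} (hk : 0 < k) {τ : Equiv.Perm ℤ}
    (hτ : ∀ n, τ (n + k) = τ n + k) {a b : ℤ} (hab : a + k < b) (hτab : τ b + k < τ a) :
    ((2 * k - 1 : ℕ) : ℕ∞) ≤ invCount k τ := by
  classical
  have := NeZero.of_pos hk
  have hτ' : ∀ n, τ (n - k) = τ n - k := fun n => by
    have := hτ (n - k)
    rw [sub_add_cancel] at this; omega
  have hne : (b : ZMod k) ≠ a := by
    intro h
    rw [← sub_eq_zero, ← Int.cast_sub, ZMod.intCast_zmod_eq_zero_iff_dvd] at h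
    obtain ⟨m, hm⟩ := h
    have := apply_add_mul hτ a m
    rw [show a + m * (k : ℤ) = b by linarith] at this
    linarith
  -- Every inversion used below involves the residue of `a` or of `b` together with a residue `c ≠
  -- a`, and `h` recovers `c`. Families for different `c` are therefore disjoint. The residue of `b`
  -- gives three classes and the other `k - 2` residues give two each, in total `2k - 1`.
  let h : ZMod k × ZMod k × ℤ → ZMod k := fun t => if t.1 = a then t.2.1 else t.1
  have key : ∀ c : ZMod k, c ≠ a → ∃ S : Finset (ZMod k × ZMod k × ℤ),
      (∀ t ∈ S, (∃ p : ℤ × ℤ, p.1 < p.2 ∧ τ p.2 < τ p.1 ∧ pairClass k p = t) ∧ h t = c) ∧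
      2 + (if c = b then 1 else 0) ≤ S.card := by
    intro c hc
    split_ifs with hcb
    · refine ⟨{pairClass k (a, b - k), pairClass k (a, b), pairClass k (a, b + k)}, ?_, ?_⟩
      · intro t ht
        simp only [Finset.mem_insert, Finset.mem_singleton] at ht
        rcases ht with rfl | rfl | rfl
        · exact ⟨⟨_, by simp; omega, by simp only [hτ']; omega, rfl⟩, by simp [h, pairClass, hcb]⟩
        · exact ⟨⟨_, by simp; omega, by simp only; omega, rfl⟩, by simp [h, pairClass, hcb]⟩
        · exact ⟨⟨_, by simp; omega, by simp only [hτ]; omega, rfl⟩, by simp [h, pairClass, hcb]⟩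
      · rw [Finset.card_eq_three.2 ⟨_, _, _, _, _, _, rfl⟩]
        all_goals
          simp only [pairClass, ne_eq, Prod.mk.injEq, not_and]
          intros
          omega
    · obtain ⟨c', hac, hca, rfl⟩ : ∃ c' : ℤ, a < c' ∧ c' < a + k ∧ (c' : ZMod k) = c := by
        refine ⟨a + ((c - a : ZMod k).val : ℤ), ?_, ?_, ?_⟩
        · have : (c - a : ZMod k).val ≠ 0 := by
            rw [ne_eq, ZMod.val_eq_zero, sub_eq_zero]; exact hc
          omega
        · have := ZMod.val_lt (c - a : ZMod k)
          omega
        · simp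
      have hv : τ c' ≠ τ a := fun h => by have := τ.injective h; omega
      -- The value `τ c'` is more than `k` below `τ a`, or below it by at most `k`, or above it. The
      -- respective pairs are `(a, c'), (a, c' + k)`, then `(a, c'), (c', b)`, then `(c', b), (c' -
      -- k, b)`.
      by_cases h1 : τ c' + k < τ a
      · refine ⟨{pairClass k (a, c'), pairClass k (a, c' + k)}, ?_, ?_⟩
        · intro t ht
          simp only [Finset.mem_insert, Finset.mem_singleton] at ht
          rcases ht with rfl | rfl
          · exact ⟨⟨_, by simp; omega, by simp only; omega, rfl⟩, by simp [h, pairClass]⟩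
          · exact ⟨⟨_, by simp; omega, by simp only [hτ]; omega, rfl⟩, by simp [h, pairClass]⟩
        · rw [Finset.card_pair]
          simp only [pairClass, ne_eq, Prod.mk.injEq, not_and]
          intros
          omega
      · by_cases h2 : τ c' < τ a
        · refine ⟨{pairClass k (a, c'), pairClass k (c', b)}, ?_, ?_⟩
          · intro t ht
            simp only [Finset.mem_insert, Finset.mem_singleton] at ht
            rcases ht with rfl | rfl
            · exact ⟨⟨_, by simp; omega, by simp only; omega, rfl⟩, by simp [h, pairClass]⟩
            · exact ⟨⟨_, by simp; omega, by simp only; omega, rfl⟩, by simp [h, pairClass, hc]⟩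
          · rw [Finset.card_pair]
            simp only [pairClass, ne_eq, Prod.mk.injEq, not_and]
            exact fun h => absurd h.symm hc
        · refine ⟨{pairClass k (c', b), pairClass k (c' - k, b)}, ?_, ?_⟩
          · intro t ht
            simp only [Finset.mem_insert, Finset.mem_singleton] at ht
            rcases ht with rfl | rfl
            · exact ⟨⟨_, by simp; omega, by simp only; omega, rfl⟩, by simp [h, pairClass, hc]⟩
            · exact ⟨⟨_, by simp; omega, by simp only [hτ']; omega, rfl⟩,
                by simp [h, pairClass, hc]⟩
          · rw [Finset.card_pair]
            simp only [pairClass, ne_eq, Prod.mk.injEq, not_and]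
            intros
            omega
  choose! S hS hcard using key
  set F := ((Finset.univ : Finset (ZMod k)).erase a).biUnion S with hF
  have hFcard : 2 * k - 1 ≤ F.card := by
    rw [hF, Finset.card_biUnion]
    · calc 2 * k - 1 = ∑ c ∈ (Finset.univ : Finset (ZMod k)).erase a,
            (2 + if c = b then 1 else 0) := by
            rw [Finset.sum_add_distrib, Finset.sum_ite_eq', if_pos (by simp [hne]),
              Finset.sum_const, Finset.card_erase_of_mem (Finset.mem_univ _), Finset.card_univ,
              ZMod.card, smul_eq_mul]
            omega
        _ ≤ _ := Finset.sum_le_sum fun c hc => hcard c (Finset.ne_of_mem_erase hc)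
    · intro c hc c' hc' hcc
      rw [Function.onFun, Finset.disjoint_left]
      intro t ht ht'
      exact hcc ((hS c (Finset.ne_of_mem_erase hc) t ht).2.symm.trans
        (hS c' (Finset.ne_of_mem_erase hc') t ht').2)
  refine le_trans (by exact_mod_cast hFcard) (card_le_invCount F ?_)
  intro t ht
  obtain ⟨c, hc, ht⟩ := Finset.mem_biUnion.1 ht
  exact (hS c (Finset.ne_of_mem_erase hc) t ht).1

/-- All pairs in `A × B` are inversions. If two distinct ones were equivalent they would differ by
`m * k` with `m ≥ 1`. The first entry of the lower pair and its value are then separated by more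
than `k` from the second entry and its value, and `two_mul_sub_one_le_invCount` exceeds `g`. -/
lemma card_mul_card_le_of_invCount_le {k g : ℕ} (hk : 0 < k) (hg : g + 2 ≤ 2 * k)
    {τ : Equiv.Perm ℤ} (hτ : ∀ n, τ (n + k) = τ n + k) (hinv : invCount k τ ≤ g)
    (A B : Finset ℤ) (hA : ∀ n ∈ A, n < 0 ∧ 0 < τ n) (hB : ∀ n ∈ B, 0 ≤ n ∧ τ n ≤ 0) :
    A.card * B.card ≤ g := by
  classical
  have main : ∀ p ∈ A ×ˢ B, ∀ q ∈ A ×ˢ B, pairClass k p = pairClass k q → ¬ p.1 < q.1 := by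
    rintro ⟨x, y⟩ hp ⟨x', y'⟩ hq heq hlt
    rw [Finset.mem_product] at hp hq
    obtain ⟨h1, m, hm⟩ := pairClass_eq_iff.1 heq.symm
    simp only at h1 hm hlt hp hq
    have hx := hA _ hp.1
    have hx' := hA _ hq.1
    have hy := hB _ hp.2
    have hy' := hB _ hq.2
    have hm1 : (k : ℤ) ≤ m * k := by
      have : 0 < m := by
        by_contra! h
        have : (k : ℤ) * m ≤ 0 := mul_nonpos_of_nonneg_of_nonpos (Nat.cast_nonneg _) h
        omega
      have hk' : (0 : ℤ) < k := by exact_mod_cast hk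
      nlinarith
    have e1 : y' = y + m * k := by linarith
    rw [e1, apply_add_mul hτ] at hy'
    have := two_mul_sub_one_le_invCount hk hτ (a := x) (b := y) (by linarith) (by linarith)
    have := this.trans hinv
    rw [Nat.cast_le] at this
    omega
  have hinj : Set.InjOn (pairClass k) (A ×ˢ B : Finset (ℤ × ℤ)) := by
    intro p hp q hq heq
    have h1 := main p hp q hq heq
    have h2 := main q hq p hp heq.symm
    have h3 := (pairClass_eq_iff.1 heq).1
    exact Prod.ext (by omega) (by omega)
  have hle := card_le_invCount (τ := τ) ((A ×ˢ B).image (pairClass k)) (by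
    intro t ht
    obtain ⟨p, hp, rfl⟩ := Finset.mem_image.1 ht
    rw [Finset.mem_product] at hp
    have hx := hA _ hp.1
    have hy := hB _ hp.2
    exact ⟨p, by omega, by omega, rfl⟩)
  rw [Finset.card_image_of_injOn hinj, Finset.card_product] at hle
  exact_mod_cast hle.trans hinv

/-- Telescoping a rank function along a row. -/
lemma sub_eq_card_filter {s : ℤ → ℤ → ℤ} {τ : Equiv.Perm ℤ}
    (h : ∀ a b, s a b - s a (b + 1) = if τ b ≤ a then 1 else 0) (a b : ℤ) (n : ℕ) :
    s a b - s a (b + n) = ((Finset.Ico b (b + n)).filter fun m => τ m ≤ a).card := by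
  induction n with
  | zero => simp
  | succ n ih =>
    have e : Finset.Ico b (b + (n + 1 : ℕ)) = insert (b + n) (Finset.Ico b (b + n)) := by
      ext x; simp only [Finset.mem_Ico, Finset.mem_insert]; omega
    have h1 := h a (b + n)
    rw [e, Finset.filter_insert]
    split_ifs at h1 ⊢ with h2
    · rw [Finset.card_insert_of_notMem (by simp)]
      push_cast; rw [← add_assoc]; linarith
    · push_cast; rw [← add_assoc]; linarith

end AffinePermutations

/-! ### General transmission with large `k` implies Brill–Noether generality. -/

section BrillNoether

variable {α : Type*} {β : Type*} {G : Graph α β}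

theorem isBrillNoetherGeneral_of_hasGeneralTransmission (hG : IsFiniteConnectedLoopless G)
    (u v : G.vertexSet) (k : ℕ) (h : HasGeneralTransmission u v k)
    (hgk : genus G + 2 ≤ 2 * k) : IsBrillNoetherGeneral G := by
  have hfin := hG.finite_vertexSet.to_subtype
  have hne := hG.connected.nonempty
  obtain ⟨hk, huv, hD⟩ := h
  rintro d r ⟨hr, D, hd, hrD⟩
  simp only at hr hd hrD
  obtain ⟨hsub, hinv⟩ := hD D
  let s : ℤ → ℤ → ℤ := fun a b => rank (D + a • chip u - b • chip v) + 1
  have hs : ∀ a b, s a b = rank (D + a • chip u - b • chip v) + 1 := fun _ _ => rfl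
  have hdeg : ∀ a b : ℤ, deg (D + a • chip u - b • chip v) = d + a - b := fun a b => by
    rw [deg_sub, deg_add, deg_zsmul, deg_zsmul, deg_chip, deg_chip, hd]; ring
  have hu : ∀ a b : ℤ, D + a • chip u - b • chip v - chip u =
      D + (a - 1) • chip u - b • chip v := fun a b => by rw [sub_smul, one_smul]; abel
  have hv : ∀ a b : ℤ, D + a • chip u - b • chip v - chip v =
      D + a • chip u - (b + 1) • chip v := fun a b => by rw [add_smul, one_smul]; abel
  obtain ⟨C₁, hC₁⟩ := exists_forall_le_rank hG
  obtain ⟨C₂, hC₂⟩ := exists_forall_rank_le hG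
  have hΔ : ∀ a b, rankDelta u v (D + a • chip u - b • chip v) =
      s a b - s (a - 1) b - s a (b + 1) + s (a - 1) (b + 1) := fun a b => by
    simp only [rankDelta, hu, hv, hs]; ring
  obtain ⟨τ, hτ, hrow⟩ := exists_perm_of_submodular (s := s) hk
    -- The entry `d` serves the vanishing in negative degree, and `C₁ - d` serves the lower bound
    -- for the rank.
    (L := max (C₁ - d) d)
    (fun a b => by
      have e1 := rank_sub_one_le (D + a • chip u - b • chip v) u
      have e2 := rank_sub_chip_le (D + a • chip u - b • chip v) u
      rw [hu] at e1 e2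
      simp only [hs]; omega)
    (fun a b => by
      have e1 := rank_sub_one_le (D + a • chip u - b • chip v) v
      have e2 := rank_sub_chip_le (D + a • chip u - b • chip v) v
      rw [hv] at e1 e2
      simp only [hs]; omega)
    (fun a b => by
      rw [← hΔ]
      have := hsub a (-b)
      rwa [neg_smul, ← sub_eq_add_neg] at this)
    (fun a b => by
      simp only [hs]
      congr 1
      refine rank_congr ?_
      obtain ⟨f, hf⟩ := huv.symm
      refine ⟨-f, ?_⟩
      rw [firing_neg, eq_sub_of_add_eq' hf.symm]
      simp only [add_smul, natCast_zsmul]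
      abel)
    (fun a b hab => by
      simp only [hs]
      rw [rank_eq_neg_one (by rw [hdeg]; omega)]; rfl)
    (fun a b => by
      have := hC₁ (D + a • chip u - b • chip v)
      rw [hdeg] at this
      simp only [hs]; omega)
  have hcnt : invCount k τ ≤ (genus G : ℕ∞) := by
    refine hinv τ fun a b => ?_
    rw [hΔ]
    have e1 := hrow a b
    have e2 := hrow (a - 1) b
    split_ifs at e1 e2 ⊢ <;> omega
  set r₀ := rank D with hr₀
  have hs0 : s 0 0 = r₀ + 1 := by simp [hs, hr₀]
  -- the values `n ≥ 0` with `τ n ≤ 0`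
  have hB := sub_eq_card_filter hrow 0 0 (d + 1).toNat
  have hs1 : s 0 (0 + (d + 1).toNat) = 0 := by
    rw [hs, rank_eq_neg_one (by rw [hdeg]; omega)]; rfl
  rw [hs0, hs1] at hB
  -- the values `n < 0` with `τ n > 0`
  set N := (C₂ - d).toNat with hN
  have hA := sub_eq_card_filter hrow 0 (-N) N
  rw [neg_add_cancel, hs0] at hA
  have hs2 : s 0 (-N) ≤ d + N - genus G + 1 := by
    have := hC₂ (D + (0 : ℤ) • chip u - (-N : ℤ) • chip v) (by rw [hdeg]; omega)
    rw [hdeg] at this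
    rw [hs]; omega
  have hsplit := Finset.card_filter_add_card_filter_not (s := Finset.Ico (-N : ℤ) 0)
    (fun m => τ m ≤ 0)
  rw [Int.card_Ico] at hsplit
  have hprod := card_mul_card_le_of_invCount_le hk hgk hτ hcnt
    ((Finset.Ico (-N : ℤ) 0).filter fun m => ¬ τ m ≤ 0)
    ((Finset.Ico (0 : ℤ) (0 + (d + 1).toNat)).filter fun m => τ m ≤ 0)
    (fun n hn => by simp only [Finset.mem_filter, Finset.mem_Ico] at hn; omega)
    (fun n hn => by simp only [Finset.mem_filter, Finset.mem_Ico] at hn; omega)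
  set x := ((Finset.Ico (0 : ℤ) (0 + (d + 1).toNat)).filter fun m => τ m ≤ 0).card
  set y := ((Finset.Ico (-N : ℤ) 0).filter fun m => ¬ τ m ≤ 0).card
  have hprod' : (y : ℤ) * x ≤ genus G := by exact_mod_cast hprod
  -- On `[-N, 0)` the row drops by at most `d + N - g - r₀`, so at least `g - d + r₀` of these `N`
  -- integers have positive value. Only the upper bound for the rank in large degree enters.
  have hy : genus G - d + r₀ ≤ y := by omega
  rw [brillNoetherNumber, sub_nonneg]
  rcases le_or_gt ((genus G : ℤ) - d + r) 0 with h0 | h0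
  · exact (mul_nonpos_of_nonneg_of_nonpos (by omega) h0).trans (Nat.cast_nonneg _)
  · calc (r + 1) * ((genus G : ℤ) - d + r) ≤ x * y :=
          mul_le_mul (by omega) (by omega) h0.le (Nat.cast_nonneg _)
      _ ≤ genus G := by rw [mul_comm]; exact hprod'

end BrillNoether

/-! ### Sorting adjacent values and the growth of the inversion count. -/

section InversionCover

/-- Every inversion of `τ` is a translate, by a multiple of `k`, of one of at most `m` pairs. -/
def InversionCover (k : ℕ) (τ : Equiv.Perm ℤ) (m : ℕ) : Prop :=
  ∃ F : Finset (ℤ × ℤ), F.card ≤ m ∧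
    ∀ a b : ℤ, a < b → τ b < τ a → ∃ t : ℤ, (a + t * k, b + t * k) ∈ F

lemma InversionCover.invCount_le {k m : ℕ} {τ : Equiv.Perm ℤ} (h : InversionCover k τ m) :
    invCount k τ ≤ m := by
  obtain ⟨F, hF, h⟩ := h
  have h' : ∀ q : Quotient (kEquiv k τ), ∃ t : ℤ,
      (q.out.1.1 + t * k, q.out.1.2 + t * k) ∈ F := fun q => h _ _ q.out.2.1 q.out.2.2
  choose t ht using h'
  have hle : invCount k τ ≤ ENat.card F := by
    refine ENat.card_le_card_of_injective
      (f := fun q : Quotient (kEquiv k τ) =>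
        (⟨(q.out.1.1 + t q * k, q.out.1.2 + t q * k), ht q⟩ : F)) ?_
    intro q q' hq
    simp only [Subtype.mk.injEq, Prod.mk.injEq] at hq
    rw [← Quotient.out_eq q, ← Quotient.out_eq q']
    refine Quotient.sound (s := kEquiv k τ) ⟨by linarith [hq.1, hq.2], t q' - t q, ?_⟩
    linarith [hq.1]
  refine hle.trans ?_
  simpa using hF

lemma InversionCover.shift {k m : ℕ} {τ : Equiv.Perm ℤ} (h : InversionCover k τ m) :
    InversionCover k ((Equiv.addRight 1).trans τ) m := by
  classical
  obtain ⟨F, hF, h⟩ := h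
  refine ⟨F.image fun p => (p.1 - 1, p.2 - 1), Finset.card_image_le.trans hF, ?_⟩
  intro a b hab hτ
  obtain ⟨t, ht⟩ := h (a + 1) (b + 1) (by omega) (by simpa using hτ)
  exact ⟨t, Finset.mem_image.2 ⟨_, ht, by ext <;> (simp; ring)⟩⟩

/-- The affine transposition exchanging `n` and `n + 1` for every `n` satisfying `P`. -/
noncomputable def adjacentSwap (P : ℤ → Prop) (hP : ∀ n, P n → ¬ P (n + 1)) : Equiv.Perm ℤ :=
  open scoped Classical in
  Function.Involutive.toPerm
    (fun n => if P n then n + 1 else if P (n - 1) then n - 1 else n) (by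
      intro n
      have h1 := hP n
      have h2 := hP (n - 1)
      have h3 := hP (n - 1 - 1)
      simp only [sub_add_cancel] at h2 h3
      by_cases h : P n <;> by_cases h' : P (n - 1) <;> simp_all)

open scoped Classical in
lemma adjacentSwap_apply (P : ℤ → Prop) (hP : ∀ n, P n → ¬ P (n + 1)) (n : ℤ) :
    adjacentSwap P hP n = if P n then n + 1 else if P (n - 1) then n - 1 else n := rfl

/-- Sorting adjacent pairs of values of an affine permutation into descending order adds at most
one class of inversions. -/
lemma exists_sorted {k m : ℕ} {τ : Equiv.Perm ℤ} (hτ : ∀ n, τ (n + k) = τ n + k)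
    (hcov : InversionCover k τ m) {P : ℤ → Prop} {c : ℤ} (hP : ∀ n, P n → ¬ P (n + 1))
    (hPc : ∀ n, P n ↔ ∃ t : ℤ, n = c + t * k) :
    ∃ σ : Equiv.Perm ℤ, (∀ n, σ (n + k) = σ n + k) ∧ InversionCover k σ (m + 1) ∧
      (∀ n, P n → σ n = max (τ n) (τ (n + 1))) ∧
      (∀ n, P n → σ (n + 1) = min (τ n) (τ (n + 1))) ∧
      (∀ n, ¬ P n → ¬ P (n - 1) → σ n = τ n) := by
  classical
  -- By periodicity all the pairs to be sorted are in the same relative order, so either all of them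
  -- are swapped or none is.
  have hval : ∀ n, P n → (τ n < τ (n + 1) ↔ τ c < τ (c + 1)) := by
    intro n hn
    obtain ⟨t, rfl⟩ := (hPc n).1 hn
    rw [add_right_comm, apply_add_mul hτ, apply_add_mul hτ]
    omega
  obtain ⟨F, hF, hFτ⟩ := hcov
  by_cases hc : τ c < τ (c + 1)
  · set s := adjacentSwap P hP with hs
    have hPt : ∀ n t : ℤ, P (n + t * k) ↔ P n := by
      intro n t
      rw [hPc, hPc]
      constructor
      · rintro ⟨u, hu⟩; exact ⟨u - t, by linarith⟩
      · rintro ⟨u, hu⟩; exact ⟨u + t, by linarith⟩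
    have hst : ∀ n t : ℤ, s (n + t * k) = s n + t * k := by
      intro n t
      rw [hs, adjacentSwap_apply, adjacentSwap_apply, add_sub_right_comm, hPt, hPt]
      split_ifs <;> ring
    have hss : ∀ n, s (s n) = n := fun n => Function.Involutive.toPerm_involutive _ n
    have hs1 : ∀ n, P n → s n = n + 1 := fun n hn => by rw [hs, adjacentSwap_apply, if_pos hn]
    have hs2 : ∀ n, P n → s (n + 1) = n := fun n hn => by
      rw [hs, adjacentSwap_apply, if_neg (hP n hn), add_sub_cancel_right, if_pos hn]
    refine ⟨s.trans τ, fun n => ?_, ?_, fun n hn => ?_, fun n hn => ?_, fun n hn hn' => ?_⟩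
    · have := hst n 1
      rw [one_mul] at this
      rw [Equiv.trans_apply, Equiv.trans_apply, this, hτ]
    · refine ⟨insert (c, c + 1) (F.image fun p => (s p.1, s p.2)),
        (Finset.card_insert_le _ _).trans (Nat.succ_le_succ (Finset.card_image_le.trans hF)), ?_⟩
      intro a b hab hτab
      rw [Equiv.trans_apply, Equiv.trans_apply] at hτab
      by_cases hsab : s a < s b
      · obtain ⟨t, ht⟩ := hFτ _ _ hsab hτab
        exact ⟨t, Finset.mem_insert_of_mem (Finset.mem_image.2 ⟨_, ht, by
          simp only [← hst, hss]⟩)⟩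
      -- The only increasing pairs whose order `s` reverses are the swapped neighbours, and these
      -- form the single class of `(c, c + 1)`.
      · have hab' : P a ∧ b = a + 1 := by
          have e1 := adjacentSwap_apply P hP a
          have e2 := adjacentSwap_apply P hP b
          rw [← hs] at e1 e2
          have hne : s a ≠ s b := fun h => hab.ne (s.injective h)
          have h3 := hP a
          split_ifs at e1 e2 with p1 p2 p3 p4 p5
          all_goals first
            | omega
            | exact ⟨p1, by omega⟩
        obtain ⟨ha, rfl⟩ := hab'
        obtain ⟨t, rfl⟩ := (hPc a).1 ha
        exact ⟨-t, Finset.mem_insert.2 (Or.inl (by ext <;> simp only <;> ring))⟩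
    · have := (hval n hn).2 hc
      rw [Equiv.trans_apply, hs1 n hn, max_eq_right this.le]
    · have := (hval n hn).2 hc
      rw [Equiv.trans_apply, hs2 n hn, min_eq_left this.le]
    · rw [Equiv.trans_apply, hs, adjacentSwap_apply, if_neg hn, if_neg hn']
  · refine ⟨τ, hτ, ⟨F, hF.trans (Nat.le_succ m), hFτ⟩, fun n hn => ?_, fun n hn => ?_,
      fun n _ _ => rfl⟩
    · exact (max_eq_left (not_lt.1 ((hval n hn).not.2 hc))).symm
    · exact (min_eq_right (not_lt.1 ((hval n hn).not.2 hc))).symm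

end InversionCover

/-! ### A recursive model of the Picard group and ranks of a chain of cycles. -/

section ChainModel

/-- The Picard group of an infinite chain of cycles with torsion order `K + 1`. -/
abbrev ChainPic (K : ℕ) : Type := ℤ × (ℕ → ZMod (K + 1))

/-- The class of the `w`-th vertex of the chain. -/
def chainPoint (K w : ℕ) : ChainPic K := (1, fun i => ((min (w - i * K) K : ℕ) : ZMod (K + 1)))

/-- Effectivity of classes on the chain of `m` cycles. -/
def ChainEff (K : ℕ) : ℕ → ChainPic K → Prop
  | 0, x => 0 ≤ x.1
  | m + 1, x => (x.2 m = 0 ∧ ChainEff K m x) ∨ ChainEff K m (x - chainPoint K (m * K))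

/-- Classes of rank at least `n` on the chain of `m` cycles. -/
def ChainRankGE (K m : ℕ) : ℕ → ChainPic K → Prop
  | 0, x => ChainEff K m x
  | n + 1, x => ∀ w ≤ m * K, ChainRankGE K m n (x - chainPoint K w)

/-- Two classes agree on the chain of `m` cycles. -/
def ChainAgree {K : ℕ} (m : ℕ) (x y : ChainPic K) : Prop := x.1 = y.1 ∧ ∀ i < m, x.2 i = y.2 i

variable {K : ℕ}

lemma ChainAgree.symm {m : ℕ} {x y : ChainPic K} (h : ChainAgree m x y) : ChainAgree m y x :=
  ⟨h.1.symm, fun i hi => (h.2 i hi).symm⟩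

lemma ChainAgree.refl (m : ℕ) (x : ChainPic K) : ChainAgree m x x := ⟨rfl, fun _ _ => rfl⟩

lemma ChainAgree.add {m : ℕ} {x y x' y' : ChainPic K} (h : ChainAgree m x y)
    (h' : ChainAgree m x' y') : ChainAgree m (x + x') (y + y') :=
  ⟨by simp [h.1, h'.1], fun i hi => by simp [h.2 i hi, h'.2 i hi]⟩

lemma ChainAgree.sub {m : ℕ} {x y x' y' : ChainPic K} (h : ChainAgree m x y)
    (h' : ChainAgree m x' y') : ChainAgree m (x - x') (y - y') :=
  ⟨by simp [h.1, h'.1], fun i hi => by simp [h.2 i hi, h'.2 i hi]⟩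

lemma ChainAgree.zsmul {m : ℕ} {x y : ChainPic K} (n : ℤ) (h : ChainAgree m x y) :
    ChainAgree m (n • x) (n • y) :=
  ⟨by simp [h.1], fun i hi => by simp [h.2 i hi]⟩

@[simp] lemma chainPoint_fst (w : ℕ) : (chainPoint K w).1 = 1 := rfl

lemma chainPoint_snd_of_le {w i : ℕ} (h : w ≤ i * K) : (chainPoint K w).2 i = 0 := by
  simp [chainPoint, Nat.sub_eq_zero_of_le h]

lemma chainPoint_snd_add {i j : ℕ} (h : j ≤ K) : (chainPoint K (i * K + j)).2 i = j := by
  simp [chainPoint, h]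

lemma natCast_self_eq_neg_one : (K : ZMod (K + 1)) = -1 := by
  rw [eq_neg_iff_add_eq_zero]
  exact_mod_cast ZMod.natCast_self (K + 1)

lemma chainPoint_snd_of_ge {w i : ℕ} (h : (i + 1) * K ≤ w) : (chainPoint K w).2 i = -1 := by
  rw [← natCast_self_eq_neg_one]
  have : K ≤ w - i * K := by rw [add_mul, one_mul] at h; omega
  simp [chainPoint, this]

/-- Seen from the first `m` cycles, a chip further along the chain is the same as a chip at the
attaching vertex `m * K`. -/
lemma chainAgree_chainPoint {m w : ℕ} (h : m * K ≤ w) :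
    ChainAgree m (chainPoint K w) (chainPoint K (m * K)) :=
  ⟨rfl, fun i hi => by
    have : (i + 1) * K ≤ m * K := Nat.mul_le_mul_right K hi
    rw [chainPoint_snd_of_ge (this.trans h), chainPoint_snd_of_ge this]⟩

lemma ChainEff.of_agree {m : ℕ} : ∀ {x y : ChainPic K}, ChainAgree m x y → ChainEff K m x →
    ChainEff K m y := by
  induction m with
  | zero => intro x y h; simp only [ChainEff, h.1]; exact id
  | succ m ih =>
    intro x y h hx
    have h' : ChainAgree m x y := ⟨h.1, fun i hi => h.2 i (by omega)⟩
    rcases hx with ⟨h1, h2⟩ | h1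
    · exact Or.inl ⟨h.2 m (by omega) ▸ h1, ih h' h2⟩
    · exact Or.inr (ih (h'.sub (.refl _ _)) h1)

lemma ChainRankGE.of_agree {m n : ℕ} : ∀ {x y : ChainPic K}, ChainAgree m x y →
    ChainRankGE K m n x → ChainRankGE K m n y := by
  induction n with
  | zero => exact fun h => ChainEff.of_agree h
  | succ n ih => exact fun h hx w hw => ih (h.sub (.refl _ _)) (hx w hw)

lemma chainRankGE_congr {m n : ℕ} {x y : ChainPic K} (h : ChainAgree m x y) :
    ChainRankGE K m n x ↔ ChainRankGE K m n y := ⟨.of_agree h, .of_agree h.symm⟩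

lemma ChainEff.add_chainPoint {m : ℕ} : ∀ {x : ChainPic K} {w : ℕ}, w ≤ m * K →
    ChainEff K m x → ChainEff K m (x + chainPoint K w) := by
  induction m with
  | zero =>
    intro x w _ h
    simp only [ChainEff, Prod.fst_add, chainPoint_fst] at h ⊢
    omega
  | succ m ih =>
    intro x w hw h
    rcases le_or_gt w (m * K) with hle | hgt
    · rcases h with ⟨h1, h2⟩ | h1
      · exact Or.inl ⟨by simp [h1, chainPoint_snd_of_le hle], ih hle h2⟩
      · refine Or.inr ?_
        rw [add_sub_right_comm]
        exact ih hle h1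
    · have hx : ChainEff K m x := by
        rcases h with ⟨-, h2⟩ | h1
        · exact h2
        · simpa using ih le_rfl h1
      refine Or.inr (ChainEff.of_agree ?_ hx)
      have := ((ChainAgree.refl m x).add (chainAgree_chainPoint hgt.le)).sub
        (.refl m (chainPoint K (m * K)))
      rw [add_sub_cancel_right] at this
      exact this.symm

lemma ChainRankGE.add_chainPoint {m n : ℕ} : ∀ {x : ChainPic K} {w : ℕ}, w ≤ m * K →
    ChainRankGE K m n x → ChainRankGE K m n (x + chainPoint K w) := by
  induction n with
  | zero => exact fun h => ChainEff.add_chainPoint h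
  | succ n ih =>
    intro x w hw h w' hw'
    rw [add_sub_right_comm]
    exact ih hw (h w' hw')

open scoped Classical in
/-- Gluing one more cycle to the end of a chain. -/
lemma chainRankGE_succ_iff (hK : 0 < K) {m n : ℕ} : ∀ x : ChainPic K,
    ChainRankGE K (m + 1) n x ↔
      (if x.2 m = 0 then ChainRankGE K m n x else ChainRankGE K m n (x - chainPoint K (m * K))) ∧
      (n = 0 ∨ ChainRankGE K m (n - 1) (x - chainPoint K (m * K) - chainPoint K (m * K))) := by
  set v := chainPoint K (m * K) with hv
  have hle : m * K ≤ (m + 1) * K := Nat.mul_le_mul_right K (Nat.le_succ m)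
  induction n with
  | zero =>
    intro x
    simp only [ChainRankGE, ChainEff, ← hv, true_or, and_true]
    split_ifs with h
    · simp only [h, true_and, or_iff_left_iff_imp]
      intro h'
      simpa only [hv, sub_add_cancel] using ChainEff.add_chainPoint le_rfl h'
    · simp [h]
  | succ n ih =>
    intro x
    have hagree : ∀ w, m * K ≤ w → ∀ y : ChainPic K,
        ChainAgree m (y - chainPoint K w) (y - v) := fun w hw y =>
      (ChainAgree.refl m y).sub (chainAgree_chainPoint hw)
    have hcoord : ∀ w ≤ m * K, (x - chainPoint K w).2 m = x.2 m := fun w hw => by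
      simp [chainPoint_snd_of_le hw]
    simp only [Nat.add_sub_cancel, Nat.succ_ne_zero, false_or]
    constructor
    · intro h
      constructor
      · split_ifs with hc
        · intro w hw
          have := ((ih _).1 (h w (hw.trans hle))).1
          rwa [hcoord w hw, if_pos hc] at this
        · intro w hw
          have := ((ih _).1 (h w (hw.trans hle))).1
          rw [hcoord w hw, if_neg hc] at this
          rwa [sub_right_comm]
      -- The worst test chip on the last cycle leaves a nonzero coordinate there, so a further chip
      -- must be paid at the attaching vertex. This accounts for the double subtraction.
      · obtain ⟨j, hj, hcj⟩ : ∃ j ≤ K, x.2 m - (j : ZMod (K + 1)) ≠ 0 := by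
          by_cases hc : x.2 m = 0
          · refine ⟨1, hK, ?_⟩
            have : Fact (1 < K + 1) := ⟨by omega⟩
            rw [hc]; simp
          · exact ⟨0, Nat.zero_le _, by simpa using hc⟩
        have := ((ih _).1 (h (m * K + j) (by rw [add_mul, one_mul]; omega))).1
        rw [if_neg (by rw [Prod.snd_sub, Pi.sub_apply, chainPoint_snd_add hj]; exact hcj)] at this
        exact this.of_agree ((hagree _ (by omega) x).sub (.refl _ _))
    · rintro ⟨h1, h2⟩ w hw
      rw [ih]
      rcases le_or_gt w (m * K) with hwm | hwm
      · constructor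
        · rw [hcoord w hwm]
          split_ifs at h1 ⊢ with hc
          · exact h1 w hwm
          · rw [sub_right_comm]
            exact h1 w hwm
        · cases n with
          | zero => exact Or.inl rfl
          | succ n =>
            refine Or.inr ?_
            have := h2 w hwm
            rwa [sub_right_comm, sub_right_comm x] at this
      · constructor
        · split_ifs with hc
          · refine ChainRankGE.of_agree (hagree w hwm.le x).symm ?_
            simpa only [hv, sub_add_cancel] using h2.add_chainPoint le_rfl
          · exact h2.of_agree ((hagree w hwm.le x).symm.sub (.refl _ _))
        · cases n with
          | zero => exact Or.inl rfl
          | succ n =>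
            refine Or.inr ?_
            exact (h2 _ le_rfl).of_agree
              (((hagree w hwm.le x).symm.sub (.refl _ _)).sub (.refl _ _))

lemma chainRankGE_zero_iff {n : ℕ} : ∀ x : ChainPic K, ChainRankGE K 0 n x ↔ (n : ℤ) ≤ x.1 := by
  induction n with
  | zero => intro x; simp [ChainRankGE, ChainEff]
  | succ n ih =>
    intro x
    simp only [ChainRankGE, ih, zero_mul, Nat.le_zero, forall_eq, Prod.fst_sub, chainPoint_fst]
    push_cast
    omega

/-- The ranks of all twists of a class on the chain of `m` cycles are recorded by an affine
permutation with at most `m` classes of inversions. -/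
lemma exists_chain_perm (hK : 0 < K) (m : ℕ) (x : ChainPic K) :
    ∃ τ : Equiv.Perm ℤ, (∀ n, τ (n + (K + 1 : ℕ)) = τ n + (K + 1 : ℕ)) ∧
      InversionCover (K + 1) τ m ∧ ∃ T : ℤ → ℤ → ℤ, (∀ a b, 0 ≤ T a b) ∧
        (∀ a b, T a b - T a (b + 1) = if τ b ≤ a then 1 else 0) ∧
        ∀ (a b : ℤ) (n : ℕ),
          ChainRankGE K m n (x + a • chainPoint K 0 - b • chainPoint K (m * K)) ↔
            (n : ℤ) < T a b := by
  classical
  induction m with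
  | zero =>
    refine ⟨Equiv.subRight x.1, fun n => ?_, ⟨∅, le_rfl, fun a b h1 h2 => ?_⟩,
      fun a b => max (x.1 + a - b + 1) 0, fun a b => le_max_right _ _, fun a b => ?_,
      fun a b n => ?_⟩
    · simp only [Equiv.subRight_apply]; ring
    · simp only [Equiv.subRight_apply] at h2; omega
    · simp only [Equiv.subRight_apply]
      split_ifs <;> omega
    · rw [chainRankGE_zero_iff]
      simp only [Prod.fst_sub, Prod.fst_add, Prod.smul_fst, chainPoint_fst, smul_eq_mul, mul_one]
      omega
  | succ m ih =>
    obtain ⟨τ, hτ, hcov, T, hT0, hT, hRT⟩ := ih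
    -- The end vertex of the new cycle has coordinate `-1` there, so these are the twists by `-n`
    -- end chips whose last coordinate vanishes.
    let P : ℤ → Prop := fun n => (n : ZMod (K + 1)) = -x.2 m
    have hP : ∀ n, P n → ¬ P (n + 1) := by
      intro n h1 h2
      have : Fact (1 < K + 1) := ⟨by omega⟩
      simp only [P] at h1 h2
      push_cast at h2
      rw [h1, add_eq_left] at h2
      exact one_ne_zero h2
    have hPc : ∀ n, P n ↔ ∃ t : ℤ, n = ((-x.2 m).val : ℤ) + t * (K + 1 : ℕ) := by
      intro n
      have h0 : ((((-x.2 m).val : ℕ) : ℤ) : ZMod (K + 1)) = -x.2 m := by simp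
      have h1 : P n ↔ ((((-x.2 m).val : ℕ) : ℤ) : ZMod (K + 1)) = n := by
        simp only [P]; rw [h0]; exact eq_comm
      rw [h1, ZMod.intCast_eq_intCast_iff_dvd_sub]
      constructor
      · rintro ⟨t, ht⟩; exact ⟨t, by rw [mul_comm]; omega⟩
      · rintro ⟨t, ht⟩; exact ⟨t, by rw [mul_comm] at ht; omega⟩
    obtain ⟨σ, hσ, hσcov, hmax, hmin, hid⟩ := exists_sorted hτ hcov hP hPc
    refine ⟨(Equiv.addRight 1).trans σ, fun n => ?_, hσcov.shift,
      -- This transcribes `chainRankGE_succ_iff`. Off `P` the second condition there is redundant,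
      -- because `T` drops by at most one at each step. On `P` the minimum turns two drops into one,
      -- which corresponds to sorting two values.
      fun a b => if P b then min (T a b) (T a (b + 2) + 1) else T a (b + 1),
      fun a b => ?_, fun a b => ?_, fun a b n => ?_⟩
    · simp only [Equiv.trans_apply, Equiv.coe_addRight]
      rw [add_right_comm, hσ]
    · have h1 := hT0 a b
      have h2 := hT0 a (b + 1)
      have h3 := hT0 a (b + 2)
      dsimp only
      split_ifs <;> omega
    · change _ = if σ (b + 1) ≤ a then (1 : ℤ) else 0
      have e0 := hT a b
      have e1 := hT a (b + 1)
      have e2 := hT a (b + 2)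
      dsimp only
      rw [show b + 1 + 1 = b + 2 by ring] at *
      rw [show b + 2 + 1 = b + 3 by ring] at *
      rw [show b + 1 + 2 = b + 3 by ring]
      by_cases hb : P b
      · have hb1 := hP b hb
        rw [if_pos hb, if_neg hb1, hmin b hb]
        split_ifs at e0 e1 ⊢ <;> omega
      · by_cases hb1 : P (b + 1)
        · rw [if_neg hb, if_pos hb1, hmax _ hb1, show b + 1 + 1 = b + 2 by ring]
          split_ifs at e1 e2 ⊢ <;> omega
        · rw [if_neg hb, if_neg hb1, hid _ hb1 (by simpa using hb)]
          exact e1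
    · have hle : m * K ≤ (m + 1) * K := Nat.mul_le_mul_right K (Nat.le_succ m)
      rw [chainRankGE_succ_iff hK]
      have hcoord : (x + a • chainPoint K 0 - b • chainPoint K ((m + 1) * K)).2 m = x.2 m + b := by
        simp [chainPoint_snd_of_le (Nat.zero_le _), chainPoint_snd_of_ge le_rfl]
      have hPb : x.2 m + b = 0 ↔ P b := by
        simp only [P, eq_neg_iff_add_eq_zero, add_comm (b : ZMod (K + 1))]
      have hagree : ChainAgree m (x + a • chainPoint K 0 - b • chainPoint K ((m + 1) * K))
          (x + a • chainPoint K 0 - b • chainPoint K (m * K)) :=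
        (ChainAgree.refl _ _).sub ((chainAgree_chainPoint hle).zsmul b)
      have hagree1 : ChainAgree m (x + a • chainPoint K 0 - b • chainPoint K ((m + 1) * K) -
          chainPoint K (m * K)) (x + a • chainPoint K 0 - (b + 1) • chainPoint K (m * K)) := by
        have := hagree.sub (.refl m (chainPoint K (m * K)))
        rwa [sub_sub (x + a • chainPoint K 0) (b • chainPoint K (m * K)), ← add_one_zsmul] at this
      have hagree2 : ChainAgree m (x + a • chainPoint K 0 - b • chainPoint K ((m + 1) * K) -
          chainPoint K (m * K) - chainPoint K (m * K))
          (x + a • chainPoint K 0 - (b + 2) • chainPoint K (m * K)) := by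
        have := hagree1.sub (.refl m (chainPoint K (m * K)))
        rwa [sub_sub (x + a • chainPoint K 0) ((b + 1) • _), ← add_one_zsmul,
          show b + 1 + 1 = b + 2 by ring] at this
      rw [hcoord, chainRankGE_congr hagree, chainRankGE_congr hagree1, chainRankGE_congr hagree2,
        hRT, hRT, hRT]
      simp only [hPb]
      have e1 := hT a (b + 1)
      rw [show b + 1 + 1 = b + 2 by ring] at e1
      have h3 := hT0 a (b + 2)
      cases n with
      | zero => split_ifs at e1 ⊢ <;> simp <;> omega
      | succ n => split_ifs at e1 ⊢ <;> simp <;> omega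

end ChainModel

/-! ### Chip-firing on graphs given by lists of edges. -/

section EdgeLists

/-- The graph with vertices `0, …, n - 1` and edges `0, …, m - 1`, the edge `e` joining `src e`
and `tgt e`. -/
def edgeListGraph (n m : ℕ) (src tgt : ℕ → ℕ) (hsrc : ∀ e < m, src e < n)
    (htgt : ∀ e < m, tgt e < n) : Graph ℕ ℕ where
  vertexSet := {x | x < n}
  edgeSet := {e | e < m}
  IsLink e x y := e < m ∧ ((x = src e ∧ y = tgt e) ∨ (x = tgt e ∧ y = src e))
  isLink_symm _ _ := ⟨fun _ _ h => ⟨h.1, h.2.symm.imp And.symm And.symm⟩⟩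
  eq_or_eq_of_isLink_of_isLink := by
    rintro e x y z w ⟨-, h⟩ ⟨-, h'⟩
    omega
  edge_mem_iff_exists_isLink e :=
    ⟨fun h => ⟨_, _, h, Or.inl ⟨rfl, rfl⟩⟩, fun ⟨_, _, h⟩ => h.1⟩
  left_mem_of_isLink := by
    rintro e x y ⟨h, ⟨rfl, -⟩ | ⟨rfl, -⟩⟩
    · exact hsrc e h
    · exact htgt e h

/-- The divisor with one chip at the vertex labelled `w`. -/
def labelChip {G : Graph ℕ ℕ} (w : ℕ) : Divisor G := fun x => if x.1 = w then 1 else 0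

lemma chip_eq_labelChip {G : Graph ℕ ℕ} (w : G.vertexSet) :
    (chip w : Divisor G) = labelChip w.1 := by
  ext x
  simp [chip, labelChip, Pi.single_apply, Subtype.ext_iff]

variable {n m : ℕ} {src tgt : ℕ → ℕ} {hsrc : ∀ e < m, src e < n} {htgt : ∀ e < m, tgt e < n}

local notation "Γ" => edgeListGraph n m src tgt hsrc htgt

lemma isFiniteConnectedLoopless_edgeListGraph (hn : 0 < n) (hne : ∀ e < m, src e ≠ tgt e)
    (hconn : ∀ x, x + 1 < n → ∃ e < m, src e = x ∧ tgt e = x + 1) :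
    IsFiniteConnectedLoopless Γ where
  finite_vertexSet := Set.finite_lt_nat n
  finite_edgeSet := Set.finite_lt_nat m
  loopless := ⟨fun e x ⟨h, h'⟩ => hne e h (by omega)⟩
  connected := by
    have h0 : ∀ x (hx : x < n),
        (Graph.toSimpleGraph Γ).Reachable ⟨0, hn⟩ ⟨x, hx⟩ := by
      intro x
      induction x with
      | zero => intro _; exact .refl _
      | succ x ih =>
        intro hx
        refine (ih (by omega)).trans (SimpleGraph.Adj.reachable ⟨?_, ?_⟩)
        · simp [Subtype.ext_iff]
        · obtain ⟨e, he, h1, h2⟩ := hconn x hx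
          exact ⟨e, he, Or.inl ⟨h1.symm, h2.symm⟩⟩
    have : Nonempty (Graph.vertexSet Γ) := ⟨⟨0, hn⟩⟩
    exact ⟨fun x y => (h0 x.1 x.2).symm.trans (h0 y.1 y.2)⟩

lemma genus_edgeListGraph : genus Γ = m + 1 - n := by
  have h : ∀ a : ℕ, ({x | x < a} : Set ℕ).ncard = a := fun a => by
    rw [← Nat.card_coe_set_eq]; simp
  change ({x | x < m} : Set ℕ).ncard + 1 - ({x | x < n} : Set ℕ).ncard = _
  rw [h, h]

instance : Fintype (Graph.vertexSet Γ) := Fintype.ofEquiv (Fin n) Fin.equivSubtype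

lemma sum_vertexSet_eq {M : Type*} [AddCommMonoid M] (h : ℕ → M) :
    ∑ x : Graph.vertexSet Γ, h x = ∑ x ∈ Finset.range n, h x :=
  (Finset.sum_subtype (Finset.range n) (fun _ => Finset.mem_range) h).symm

/-- Firing as a sum over the edges. -/
lemma firing_edgeListGraph (hne : ∀ e < m, src e ≠ tgt e) (F : ℕ → ℤ) :
    firing (G := Γ) (fun x => F x) =
      ∑ e ∈ Finset.range m, (F (tgt e) - F (src e)) • (labelChip (src e) - labelChip (tgt e)) := by
  classical
  ext x
  rw [firing_apply, Finset.sum_apply]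
  have hE : ((Finset.range m : Finset ℕ) : Set ℕ) = Graph.edgeSet Γ := by
    ext e; simp [edgeListGraph]
  simp only [edgeMult_eq_sum _ hE]
  push_cast
  simp only [Finset.sum_mul]
  rw [Finset.sum_comm]
  refine Finset.sum_congr rfl fun e he => ?_
  rw [Finset.mem_range] at he
  rw [sum_vertexSet_eq (fun y => (if Graph.IsLink Γ e x y then (1 : ℤ) else 0) * (F y - F x))]
  have hy : ∀ y : ℕ, (if Graph.IsLink Γ e x y then (1 : ℤ) else 0) * (F y - F x) =
      (if y = tgt e then (if x.1 = src e then F y - F x else 0) else 0) +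
      (if y = src e then (if x.1 = tgt e then F y - F x else 0) else 0) := by
    intro y
    have := hne e he
    have hl : Graph.IsLink Γ e x y ↔
        ((x.1 = src e ∧ y = tgt e) ∨ (x.1 = tgt e ∧ y = src e)) := and_iff_right he
    simp only [hl]
    split_ifs <;> omega
  simp only [hy]
  rw [Finset.sum_add_distrib, Finset.sum_ite_eq', Finset.sum_ite_eq',
    if_pos (Finset.mem_range.2 (hsrc e he)), if_pos (Finset.mem_range.2 (htgt e he))]
  simp only [Pi.smul_apply, Pi.sub_apply, labelChip, smul_eq_mul]
  have := hne e he
  split_ifs with h1 h2 h2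
  · omega
  · rw [h1]; ring
  · rw [h2]; ring
  · ring

lemma sum_smul_labelChip {A : Type*} [AddCommGroup A] (p : ℕ → A) {w : ℕ} (hw : w < n) :
    ∑ x : Graph.vertexSet Γ, (labelChip w : Divisor Γ) x • p x = p w := by
  rw [Finset.sum_eq_single (⟨w, hw⟩ : Graph.vertexSet Γ)]
  · simp [labelChip]
  · intro x _ hx
    rw [labelChip, if_neg (fun h => hx (Subtype.ext h)), zero_smul]
  · simp

/-- The homomorphism from divisors that sends the chip at `w` to `p w`. -/
def divisorLift (G : Graph ℕ ℕ) [Fintype G.vertexSet] {A : Type*} [AddCommGroup A] (p : ℕ → A) :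
    Divisor G →+ A where
  toFun D := ∑ x : G.vertexSet, D x • p x
  map_zero' := by simp
  map_add' D E := by simp [add_smul, Finset.sum_add_distrib]

lemma divisorLift_labelChip {A : Type*} [AddCommGroup A] (p : ℕ → A) {w : ℕ} (hw : w < n) :
    divisorLift Γ p (labelChip w) = p w := sum_smul_labelChip p hw

lemma divisorLift_firing (hne : ∀ e < m, src e ≠ tgt e) {A : Type*} [AddCommGroup A]
    (p : ℕ → A) (F : ℕ → ℤ) :
    divisorLift Γ p (firing fun x => F x) =
      ∑ e ∈ Finset.range m, (F (tgt e) - F (src e)) • (p (src e) - p (tgt e)) := by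
  rw [firing_edgeListGraph hne, map_sum]
  refine Finset.sum_congr rfl fun e he => ?_
  rw [Finset.mem_range] at he
  rw [map_zsmul, map_sub, divisorLift_labelChip p (hsrc e he), divisorLift_labelChip p (htgt e he)]

end EdgeLists

/-! ### The chain of cycles: Picard group, transmission and a pencil of low degree. -/

section ChainGraph

/-- The first end of an edge of the chain of cycles. -/
def chainSrc (K g e : ℕ) : ℕ := if e < g * K then e else (e - g * K) * K

/-- The second end of an edge of the chain of cycles. -/
def chainTgt (K g e : ℕ) : ℕ := if e < g * K then e + 1 else (e - g * K + 1) * K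

variable {K g : ℕ}

lemma chainSrc_lt : ∀ e < g * K + g, chainSrc K g e < g * K + 1 := by
  intro e he
  rw [chainSrc]
  split_ifs with h
  · omega
  · have : (e - g * K) * K ≤ g * K := Nat.mul_le_mul_right K (by omega)
    omega

lemma chainTgt_lt : ∀ e < g * K + g, chainTgt K g e < g * K + 1 := by
  intro e he
  rw [chainTgt]
  split_ifs with h
  · omega
  · have : (e - g * K + 1) * K ≤ g * K := Nat.mul_le_mul_right K (by omega)
    omega

lemma chainSrc_ne (hK : 0 < K) (e : ℕ) : chainSrc K g e ≠ chainTgt K g e := by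
  rw [chainSrc, chainTgt]
  split_ifs
  · omega
  · rw [add_mul, one_mul]; omega

/-- The chain of `g` cycles of length `K + 1`: the vertices `0, …, g * K` form a path, and a
further edge joins `i * K` and `(i + 1) * K` for every `i < g`. -/
abbrev chainGraph (K g : ℕ) : Graph ℕ ℕ :=
  edgeListGraph (g * K + 1) (g * K + g) (chainSrc K g) (chainTgt K g) chainSrc_lt chainTgt_lt

lemma isFiniteConnectedLoopless_chainGraph (hK : 0 < K) :
    IsFiniteConnectedLoopless (chainGraph K g) := by
  refine isFiniteConnectedLoopless_edgeListGraph (Nat.succ_pos _) (fun e _ => chainSrc_ne hK e) ?_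
  intro x hx
  have : x < g * K := by omega
  exact ⟨x, by omega, by rw [chainSrc, if_pos this], by rw [chainTgt, if_pos this]⟩

lemma genus_chainGraph : genus (chainGraph K g) = g := by
  rw [genus_edgeListGraph]; omega

/-- Splitting a sum over the edges into the path and the closing edges. -/
lemma sum_chain_edges {A : Type*} [AddCommGroup A] (F : ℕ → ℤ) (p : ℕ → A) :
    ∑ e ∈ Finset.range (g * K + g), (F (chainTgt K g e) - F (chainSrc K g e)) •
        (p (chainSrc K g e) - p (chainTgt K g e)) =
      ∑ e ∈ Finset.range (g * K), (F (e + 1) - F e) • (p e - p (e + 1)) +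
      ∑ i ∈ Finset.range g, (F ((i + 1) * K) - F (i * K)) • (p (i * K) - p ((i + 1) * K)) := by
  rw [Finset.sum_range_add]
  congr 1
  · refine Finset.sum_congr rfl fun e he => ?_
    rw [Finset.mem_range] at he
    rw [chainSrc, chainTgt, if_pos he, if_pos he]
  · refine Finset.sum_congr rfl fun e he => ?_
    rw [chainSrc, chainTgt, if_neg (by omega), if_neg (by omega), Nat.add_sub_cancel_left]

lemma chainPoint_succ_sub (hK : 0 < K) (w : ℕ) :
    chainPoint K (w + 1) - chainPoint K w = (0, Pi.single (w / K) 1) := by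
  refine Prod.ext (sub_self _) (funext fun i => ?_)
  have h1 := Nat.div_add_mod w K
  have h2 := Nat.mod_lt w hK
  rw [mul_comm] at h1
  rw [Prod.snd_sub, Pi.sub_apply]
  dsimp only
  rcases lt_trichotomy i (w / K) with h | h | h
  · have h3 : (i + 1) * K ≤ w / K * K := Nat.mul_le_mul_right K h
    rw [chainPoint_snd_of_ge (by omega), chainPoint_snd_of_ge (by omega),
      Pi.single_eq_of_ne h.ne, sub_self]
  · subst h
    have h3 := chainPoint_snd_add (K := K) (i := w / K) (j := w % K) h2.le
    have h4 := chainPoint_snd_add (K := K) (i := w / K) (j := w % K + 1) h2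
    rw [h1] at h3
    rw [← add_assoc, h1] at h4
    rw [h3, h4, Pi.single_eq_same]
    push_cast; ring
  · have h3 : (w / K + 1) * K ≤ i * K := Nat.mul_le_mul_right K h
    rw [add_mul, one_mul] at h3
    rw [chainPoint_snd_of_le (by omega), chainPoint_snd_of_le (by omega),
      Pi.single_eq_of_ne h.ne', sub_self]

/-- The class of a divisor on the chain of cycles. -/
noncomputable def chainClass (K g : ℕ) : Divisor (chainGraph K g) →+ ChainPic K :=
  divisorLift _ (chainPoint K)

lemma chainClass_chip (w : (chainGraph K g).vertexSet) :
    chainClass K g (chip w) = chainPoint K w := by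
  rw [chip_eq_labelChip]
  exact divisorLift_labelChip _ w.2

lemma exists_extend (f : (chainGraph K g).vertexSet → ℤ) : ∃ F : ℕ → ℤ, f = fun x => F x.1 :=
  open scoped Classical in
  ⟨fun x => if h : x ∈ (chainGraph K g).vertexSet then f ⟨x, h⟩ else 0, funext fun x => by
    simp⟩

/-- The sum telescopes over the path edges of cycle `i`. The `max` and `min` clip the upper end so
that induction on `n` goes through. -/
lemma sum_range_window (F : ℕ → ℤ) (i n : ℕ) (hK : 0 < K) :
    ∑ e ∈ Finset.range n, (F (e + 1) - F e) * (if e / K = i then 1 else 0) =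
      F (max (i * K) (min n (i * K + K))) - F (i * K) := by
  induction n with
  | zero => simp
  | succ n ih =>
    rw [Finset.sum_range_succ, ih]
    have h : n / K = i ↔ i * K ≤ n ∧ n < i * K + K := by
      rw [Nat.div_eq_iff hK]
      omega
    by_cases hn : n / K = i
    · have h' := h.1 hn
      rw [if_pos hn, show max (i * K) (min n (i * K + K)) = n by omega,
        show max (i * K) (min (n + 1) (i * K + K)) = n + 1 by omega]
      ring
    · have h' := (not_congr h).1 hn
      rw [if_neg hn, show max (i * K) (min (n + 1) (i * K + K)) =
        max (i * K) (min n (i * K + K)) by omega]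
      ring

/-- In the coordinate of cycle `i` the path edges contribute minus the difference of `F` between the
ends of the cycle. The closing edge contributes plus the same difference, because `K = -1` in `ZMod
(K + 1)`. -/
lemma chainClass_firing (hK : 0 < K) (f : (chainGraph K g).vertexSet → ℤ) :
    ChainAgree g (chainClass K g (firing f)) 0 := by
  obtain ⟨F, rfl⟩ := exists_extend f
  have h : chainClass K g (firing fun x => F x) = _ :=
    divisorLift_firing (fun e _ => chainSrc_ne hK e) (chainPoint K) F
  rw [h, sum_chain_edges]
  constructor
  · simp [Prod.fst_sum]
  · intro i hi
    have h1 : ∀ e, (chainPoint K e - chainPoint K (e + 1)).2 i =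
        (((if e / K = i then (-1) else 0 : ℤ)) : ZMod (K + 1)) := by
      intro e
      rw [← neg_sub, chainPoint_succ_sub hK]
      simp only [Prod.snd_neg, Pi.neg_apply, Pi.single_apply, eq_comm (a := i)]
      split_ifs <;> simp
    have h2 : ∀ j, (chainPoint K (j * K) - chainPoint K ((j + 1) * K)).2 i =
        if i = j then 1 else 0 := by
      intro j
      rw [Prod.snd_sub, Pi.sub_apply]
      split_ifs with hij
      · subst hij
        rw [chainPoint_snd_of_le le_rfl, chainPoint_snd_of_ge le_rfl]; ring
      · rcases lt_or_gt_of_ne hij with h | h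
        · have h3 : (i + 1) * K ≤ j * K := Nat.mul_le_mul_right K h
          rw [chainPoint_snd_of_ge h3, chainPoint_snd_of_ge (by rw [add_mul j]; omega), sub_self]
        · have h3 : (j + 1) * K ≤ i * K := Nat.mul_le_mul_right K h
          rw [chainPoint_snd_of_le h3, chainPoint_snd_of_le (by rw [add_mul j] at h3; omega),
            sub_self]
    simp only [Prod.snd_add, Prod.snd_sum, Pi.add_apply, Finset.sum_apply, Prod.smul_snd,
      Pi.smul_apply, h1, h2, Prod.snd_zero, Pi.zero_apply]
    simp only [zsmul_eq_mul, mul_ite (i = _), mul_one, mul_zero]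
    rw [Finset.sum_ite_eq, if_pos (Finset.mem_range.2 hi)]
    have h3 := sum_range_window F i (g * K) hK
    have h4 : i * K + K ≤ g * K := by
      have : (i + 1) * K ≤ g * K := Nat.mul_le_mul_right K hi
      rwa [add_mul, one_mul] at this
    rw [min_eq_right h4, max_eq_right (by omega)] at h3
    have h5 := congrArg (Int.cast : ℤ → ZMod (K + 1)) h3
    push_cast at h5
    have h6 : ∑ e ∈ Finset.range (g * K), ((F (e + 1) - F e : ℤ) : ZMod (K + 1)) *
        (((if e / K = i then (-1) else 0 : ℤ)) : ZMod (K + 1)) =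
        -((F (i * K + K) : ZMod (K + 1)) - F (i * K)) := by
      rw [← h5, ← Finset.sum_neg_distrib]
      refine Finset.sum_congr rfl fun e _ => ?_
      split_ifs <;> simp
    rw [h6, add_mul i, one_mul]
    push_cast
    ring

/-- The class map is injective on the Picard group since it has a left inverse `ψ`, built from the
relations that firing initial segments of the path provides. -/
lemma exists_firing_of_chainClass (hK : 0 < K) {D : Divisor (chainGraph K g)}
    (hD : ChainAgree g (chainClass K g D) 0) : ∃ f, D = firing f := by
  classical
  let Q := Divisor (chainGraph K g) ⧸ (firingHom (chainGraph K g)).range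
  let π : Divisor (chainGraph K g) →+ Q := QuotientAddGroup.mk' _
  let X : ℕ → Q := fun w => π (labelChip w)
  let t : ℕ → Q := fun i => if i < g then X (i * K) - X ((i + 1) * K) else 0
  -- Firing the vertices `0, …, w` moves chips only along the path edge from `w` to `w + 1` and
  -- along the closing edge of its cycle.
  have hstep : ∀ w < g * K, X (w + 1) - X w = t (w / K) := by
    intro w hw
    have hi : w / K < g := Nat.div_lt_of_lt_mul (by rwa [mul_comm])
    have h1 := Nat.div_add_mod w K
    have h2 := Nat.mod_lt w hK
    rw [mul_comm] at h1
    have h0 : π (firing fun x => if x.1 ≤ w then 1 else 0) = 0 :=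
      (QuotientAddGroup.eq_zero_iff _).2 ⟨_, rfl⟩
    rw [firing_edgeListGraph (fun e _ => chainSrc_ne hK e) (fun x => if x ≤ w then 1 else 0),
      map_sum] at h0
    simp only [map_zsmul, map_sub] at h0
    rw [sum_chain_edges (fun x => if x ≤ w then 1 else 0) X, Finset.sum_eq_single w,
      Finset.sum_eq_single (w / K)] at h0
    · rw [if_neg (by omega), if_pos le_rfl,
        if_neg (by rw [add_mul, one_mul]; omega), if_pos (by omega)] at h0
      simp only [t, if_pos hi]
      simp only [zero_sub, neg_smul, one_smul] at h0
      rw [← sub_eq_zero, ← h0]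
      abel
    · intro j _ hj
      rcases lt_or_gt_of_ne hj with h | h
      · have h3 : (j + 1) * K ≤ w / K * K := Nat.mul_le_mul_right K h
        have h4 : j * K ≤ (j + 1) * K := Nat.mul_le_mul_right K (by omega)
        rw [if_pos (by omega), if_pos (by omega), sub_self, zero_smul]
      · have h3 : (w / K + 1) * K ≤ j * K := Nat.mul_le_mul_right K h
        have h4 : j * K ≤ (j + 1) * K := Nat.mul_le_mul_right K (by omega)
        rw [add_mul, one_mul] at h3
        rw [if_neg (by omega), if_neg (by omega), sub_self, zero_smul]
    · intro h; exact absurd (Finset.mem_range.2 hi) h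
    · intro e _ he
      rcases lt_or_gt_of_ne he with h | h
      · rw [if_pos (by omega), if_pos (by omega), sub_self, zero_smul]
      · rw [if_neg (by omega), if_neg (by omega), sub_self, zero_smul]
    · intro h; exact absurd (Finset.mem_range.2 hw) h
  -- The `K` equal steps along cycle `i` add up to `K • t i`, and their sum is `-t i` by definition
  -- of `t`.
  have htors : ∀ i, (zmultiplesHom Q (t i)) ((K + 1 : ℕ) : ℤ) = 0 := by
    intro i
    by_cases hi : i < g
    · have hle : (i + 1) * K ≤ g * K := Nat.mul_le_mul_right K hi
      rw [add_mul, one_mul] at hle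
      have hX : ∀ j ≤ K, X (i * K + j) - X (i * K) = j • t i := by
        intro j
        induction j with
        | zero => simp
        | succ j ih =>
          intro hj
          have h1 := hstep (i * K + j) (by omega)
          have h2 : (i * K + j) / K = i := by
            rw [Nat.div_eq_iff hK]; omega
          rw [h2] at h1
          rw [succ_nsmul, ← ih (by omega), ← h1, ← add_assoc]
          abel
      have h1 := hX K le_rfl
      have h2 : t i = X (i * K) - X (i * K + K) := by
        simp only [t, if_pos hi, add_mul, one_mul]
      rw [zmultiplesHom_apply, natCast_zsmul, succ_nsmul, ← h1, h2]
      abel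
    · simp [t, hi]
  let L : ∀ i, ZMod (K + 1) →+ Q := fun i => ZMod.lift (K + 1) ⟨zmultiplesHom Q (t i), htors i⟩
  have hL1 : ∀ i, L i 1 = t i := fun i => by
    have := ZMod.lift_coe (K + 1) (⟨zmultiplesHom Q (t i), htors i⟩ :
      {f : ℤ →+ Q // f ((K + 1 : ℕ) : ℤ) = 0}) 1
    simpa using this
  let ψ : ChainPic K →+ Q :=
    (zmultiplesHom Q (X 0)).comp (AddMonoidHom.fst _ _) +
      ∑ i ∈ Finset.range g, (L i).comp ((Pi.evalAddMonoidHom _ i).comp (AddMonoidHom.snd _ _))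
  have hψ : ∀ x, ψ x = x.1 • X 0 + ∑ i ∈ Finset.range g, L i (x.2 i) := fun x => by
    simp [ψ]
  have hψX : ∀ w ≤ g * K, ψ (chainPoint K w) = X w := by
    intro w
    induction w with
    | zero =>
      intro _
      rw [hψ, Finset.sum_eq_zero, add_zero, chainPoint_fst, one_smul]
      intro i _
      rw [chainPoint_snd_of_le (Nat.zero_le _), map_zero]
    | succ w ih =>
      intro hw
      have hi : w / K < g := Nat.div_lt_of_lt_mul (by rw [mul_comm]; omega)
      have h1 : ψ (chainPoint K (w + 1) - chainPoint K w) = t (w / K) := by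
        rw [chainPoint_succ_sub hK, hψ, zero_smul, zero_add,
          Finset.sum_eq_single (w / K)]
        · dsimp only
          rw [Pi.single_eq_same, hL1]
        · intro j _ hj
          dsimp only
          rw [Pi.single_eq_of_ne hj, map_zero]
        · intro h; exact absurd (Finset.mem_range.2 hi) h
      rw [map_sub, ih (by omega), ← hstep w (by omega)] at h1
      exact sub_left_inj.1 h1
  have hcomp : ψ (chainClass K g D) = π D := by
    have hDsum : D = ∑ x, D x • labelChip x.1 := by
      ext y
      rw [Finset.sum_apply, Finset.sum_eq_single y]
      · simp [labelChip]
      · intro x _ hx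
        simp [labelChip, Subtype.ext_iff.not.1 hx.symm]
      · simp
    have h1 : chainClass K g D = ∑ x, D x • chainPoint K x.1 := rfl
    rw [h1, map_sum]
    conv_rhs => rw [hDsum, map_sum]
    refine Finset.sum_congr rfl fun x _ => ?_
    rw [map_zsmul, map_zsmul, hψX x.1 (Nat.lt_succ_iff.1 x.2)]
  have h0 : π D = 0 := by
    rw [← hcomp, hψ, hD.1, Finset.sum_eq_zero]
    · simp
    · intro i hi
      rw [hD.2 i (Finset.mem_range.1 hi)]
      simp
  obtain ⟨f, hf⟩ := (QuotientAddGroup.eq_zero_iff D).1 h0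
  exact ⟨f, hf.symm⟩

lemma linEquiv_iff_chainClass (hK : 0 < K) {D D' : Divisor (chainGraph K g)} :
    LinEquiv D D' ↔ ChainAgree g (chainClass K g D) (chainClass K g D') := by
  constructor
  · rintro ⟨f, rfl⟩
    rw [map_add]
    have := (ChainAgree.refl g (chainClass K g D)).add (chainClass_firing hK f).symm
    rwa [add_zero] at this
  · intro h
    have h1 := h.symm.sub (.refl g (chainClass K g D))
    rw [sub_self, ← map_sub] at h1
    obtain ⟨f, hf⟩ := exists_firing_of_chainClass hK h1
    exact ⟨f, by rw [← hf]; abel⟩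

lemma chainEff_zero (m : ℕ) : ChainEff K m 0 := by
  induction m with
  | zero => simp [ChainEff]
  | succ m ih => exact Or.inl ⟨rfl, ih⟩

lemma ChainEff.add_nsmul {m : ℕ} {x : ChainPic K} {w : ℕ} (hw : w ≤ m * K)
    (h : ChainEff K m x) (n : ℕ) : ChainEff K m (x + n • chainPoint K w) := by
  induction n with
  | zero => simpa using h
  | succ n ih =>
    rw [succ_nsmul, ← add_assoc]
    exact ih.add_chainPoint hw

lemma chainEff_chainClass {D : Divisor (chainGraph K g)} (hD : 0 ≤ D) :
    ChainEff K g (chainClass K g D) := by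
  classical
  have h : ∀ s : Finset (chainGraph K g).vertexSet,
      ChainEff K g (∑ x ∈ s, D x • chainPoint K x.1) := by
    intro s
    induction s using Finset.induction_on with
    | empty => simpa using chainEff_zero g
    | insert x s hx ih =>
      rw [Finset.sum_insert hx, add_comm, ← Int.toNat_of_nonneg (hD x), natCast_zsmul]
      exact ih.add_nsmul (Nat.lt_succ_iff.1 x.2) _
  exact h Finset.univ

/-- Each use of the second clause of `ChainEff` is realised by one chip on the last cycle. The
coordinates of its vertices exhaust `ZMod (K + 1)`, so the required one can be matched without
changing the picture on the earlier cycles. -/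
lemma exists_effective_of_chainEff {m : ℕ} (hm : m ≤ g) : ∀ {x : ChainPic K}, ChainEff K m x →
    ∃ D : Divisor (chainGraph K g), 0 ≤ D ∧ ChainAgree m (chainClass K g D) x ∧
      ∀ i, m ≤ i → (chainClass K g D).2 i = 0 := by
  induction m with
  | zero =>
    intro x hx
    refine ⟨x.1 • chip ⟨0, Nat.succ_pos _⟩, zsmul_nonneg (chip_nonneg _) hx, ⟨?_, ?_⟩, ?_⟩
    · rw [map_zsmul, chainClass_chip]; simp
    · intro i hi; omega
    · intro i _
      rw [map_zsmul, chainClass_chip]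
      simp [chainPoint_snd_of_le (Nat.zero_le _)]
  | succ m ih =>
    intro x hx
    rcases hx with ⟨h0, h⟩ | h
    · obtain ⟨D, hD, hag, hz⟩ := ih (by omega) h
      refine ⟨D, hD, ⟨hag.1, fun i hi => ?_⟩, fun i hi => hz i (by omega)⟩
      rcases Nat.lt_succ_iff_lt_or_eq.1 hi with hi | rfl
      · exact hag.2 i hi
      · rw [hz _ le_rfl, h0]
    · obtain ⟨D, hD, hag, hz⟩ := ih (by omega) h
      have hj : (x.2 m).val ≤ K := Nat.lt_succ_iff.1 (ZMod.val_lt _)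
      have hle : (m + 1) * K ≤ g * K := Nat.mul_le_mul_right K hm
      have hle' : m * K + (x.2 m).val ≤ (m + 1) * K := by rw [add_mul, one_mul]; omega
      refine ⟨D + chip ⟨m * K + (x.2 m).val, Nat.lt_succ_iff.2 (by omega)⟩,
        add_nonneg hD (chip_nonneg _), ?_, fun i hi => ?_⟩
      · rw [map_add, chainClass_chip]
        have h1 := hag.add (chainAgree_chainPoint (K := K) (m := m)
          (Nat.le_add_right (m * K) (x.2 m).val))
        rw [sub_add_cancel] at h1
        refine ⟨h1.1, fun i hi => ?_⟩
        rcases Nat.lt_succ_iff_lt_or_eq.1 hi with hi | rfl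
        · exact h1.2 i hi
        · rw [Prod.snd_add, Pi.add_apply, hz _ le_rfl, chainPoint_snd_add hj]
          simp
      · have : (m + 1) * K ≤ i * K := Nat.mul_le_mul_right K hi
        rw [map_add, chainClass_chip, Prod.snd_add, Pi.add_apply, hz i (by omega),
          chainPoint_snd_of_le (by dsimp only; omega), add_zero]

lemma isEquivEffective_iff_chainEff (hK : 0 < K) (D : Divisor (chainGraph K g)) :
    IsEquivEffective D ↔ ChainEff K g (chainClass K g D) := by
  constructor
  · rintro ⟨D', h, hD'⟩
    exact (chainEff_chainClass hD').of_agree ((linEquiv_iff_chainClass hK).1 h).symm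
  · intro h
    obtain ⟨D', hD', hag, -⟩ := exists_effective_of_chainEff le_rfl h
    exact ⟨D', (linEquiv_iff_chainClass hK).2 hag.symm, hD'⟩

instance : Nonempty (chainGraph K g).vertexSet := ⟨⟨0, Nat.succ_pos _⟩⟩

lemma natCast_le_rank_iff (hK : 0 < K) {n : ℕ} : ∀ D : Divisor (chainGraph K g),
    (n : ℤ) ≤ rank D ↔ ChainRankGE K g n (chainClass K g D) := by
  induction n with
  | zero =>
    intro D
    rw [Nat.cast_zero, zero_le_rank_iff, isEquivEffective_iff_chainEff hK]
    rfl
  | succ n ih =>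
    intro D
    rw [Nat.cast_succ, add_one_le_rank_iff (Nat.cast_nonneg n)]
    simp only [ih, map_sub, chainClass_chip]
    exact ⟨fun h w hw => h ⟨w, Nat.lt_succ_iff.2 hw⟩, fun h w => h w (Nat.lt_succ_iff.1 w.2)⟩

/-- The first vertex of the chain. -/
def chainFirst (K g : ℕ) : (chainGraph K g).vertexSet := ⟨0, Nat.succ_pos _⟩

/-- The last vertex of the chain. -/
def chainLast (K g : ℕ) : (chainGraph K g).vertexSet := ⟨g * K, Nat.lt_succ_self _⟩

theorem hasGeneralTransmission_chainGraph (hK : 0 < K) :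
    HasGeneralTransmission (chainFirst K g) (chainLast K g) (K + 1) := by
  refine ⟨Nat.succ_pos K, ?_, fun D => ?_⟩
  · rw [linEquiv_iff_chainClass hK, map_nsmul, map_nsmul, chainClass_chip, chainClass_chip]
    refine ⟨rfl, fun i _ => ?_⟩
    simp only [Prod.smul_snd, Pi.smul_apply]
    simp only [nsmul_eq_mul, ZMod.natCast_self, zero_mul]
  · obtain ⟨τ, -, hcov, T, hT0, hT, hRT⟩ := exists_chain_perm hK g (chainClass K g D)
    -- The model only tests natural numbers against the rank. Since both sides are at least `-1`,
    -- this determines them.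
    have hrank : ∀ a b : ℤ,
        rank (D + a • chip (chainFirst K g) - b • chip (chainLast K g)) = T a b - 1 := by
      intro a b
      have h1 : ∀ n : ℕ, (n : ℤ) ≤
          rank (D + a • chip (chainFirst K g) - b • chip (chainLast K g)) ↔ (n : ℤ) < T a b := by
        intro n
        rw [natCast_le_rank_iff hK, map_sub, map_add, map_zsmul, map_zsmul, chainClass_chip,
          chainClass_chip]
        exact hRT a b n
      have h2 := neg_one_le_rank (D + a • chip (chainFirst K g) - b • chip (chainLast K g))
      have h3 := hT0 a b
      have h4 := h1 (rank (D + a • chip (chainFirst K g) - b • chip (chainLast K g))).toNat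
      have h5 := h1 (T a b - 1).toNat
      omega
    have hΔ : ∀ a b : ℤ, rankDelta (chainFirst K g) (chainLast K g)
        (D + a • chip (chainFirst K g) - b • chip (chainLast K g)) =
        if τ b = a then 1 else 0 := by
      intro a b
      have e1 : D + a • chip (chainFirst K g) - b • chip (chainLast K g) -
          chip (chainFirst K g) =
          D + (a - 1) • chip (chainFirst K g) - b • chip (chainLast K g) := by
        rw [sub_smul, one_smul]; abel
      have e2 : ∀ a : ℤ, D + a • chip (chainFirst K g) - b • chip (chainLast K g) -
          chip (chainLast K g) =
          D + a • chip (chainFirst K g) - (b + 1) • chip (chainLast K g) := fun a => by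
        rw [add_smul, one_smul]; abel
      rw [rankDelta, e1, e2, e2, hrank, hrank, hrank, hrank]
      have h1 := hT a b
      have h2 := hT (a - 1) b
      split_ifs at h1 h2 ⊢ <;> omega
    refine ⟨fun a b => ?_, fun τ' hτ' => ?_⟩
    · have h := hΔ a (-b)
      rw [neg_smul, sub_neg_eq_add] at h
      rw [h]
      split_ifs <;> simp
    · have hττ : τ' = τ := by
        ext b
        have h1 := hτ' (τ b) b
        rw [hΔ, if_pos rfl] at h1
        by_contra hne
        rw [if_neg hne] at h1
        exact one_ne_zero h1
      rw [hττ, genus_chainGraph]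
      exact hcov.invCount_le

/-- Torsion of order `K + 1` moves the whole stack of chips to any attaching vertex. To reach a
vertex at interior position `j` of a cycle, two chips at its first vertex move to the opposite
positions `j` and `K + 1 - j`. -/
lemma chainEff_smul_sub (hK : 0 < K) {w : ℕ} (hw : w ≤ g * K) :
    ChainEff K g ((K + 1 : ℕ) • chainPoint K 0 - chainPoint K w) := by
  have h1 := Nat.div_add_mod w K
  have h2 := Nat.mod_lt w hK
  rw [mul_comm] at h1
  set i := w / K with hi
  set j := w % K with hj
  rcases Nat.eq_zero_or_pos j with h0 | h0
  · have key : (K + 1 : ℕ) • chainPoint K 0 - chainPoint K w = 0 + K • chainPoint K w := by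
      rw [zero_add, sub_eq_iff_eq_add, ← succ_nsmul]
      refine Prod.ext (by simp) (funext fun l => ?_)
      simp only [Prod.smul_snd, Pi.smul_apply]
      simp only [nsmul_eq_mul, ZMod.natCast_self, zero_mul]
    rw [key]
    exact (chainEff_zero g).add_nsmul hw K
  · have hig : i < g := by
      by_contra! h
      have : g * K ≤ i * K := Nat.mul_le_mul_right K h
      omega
    have hle : (i + 1) * K ≤ g * K := Nat.mul_le_mul_right K hig
    rw [add_mul, one_mul] at hle
    have key : (K + 1 : ℕ) • chainPoint K 0 - chainPoint K w =
        0 + (K - 1) • chainPoint K (i * K) + chainPoint K (i * K + (K + 1 - j)) := by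
      rw [zero_add, sub_eq_iff_eq_add]
      refine Prod.ext ?_ (funext fun l => ?_)
      · simp only [Prod.smul_fst, Prod.fst_add, chainPoint_fst]
        simp only [nsmul_eq_mul]
        push_cast [Nat.cast_sub hK]
        ring
      · simp only [Prod.smul_snd, Pi.smul_apply, Prod.snd_add, Pi.add_apply]
        simp only [nsmul_eq_mul, ZMod.natCast_self, zero_mul]
        rw [Nat.cast_sub hK, natCast_self_eq_neg_one]
        rcases lt_trichotomy l i with h | rfl | h
        · have h3 : (l + 1) * K ≤ i * K := Nat.mul_le_mul_right K h
          rw [chainPoint_snd_of_ge h3, chainPoint_snd_of_ge (by omega),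
            chainPoint_snd_of_ge (by omega)]
          push_cast; ring
        · rw [chainPoint_snd_of_le le_rfl, chainPoint_snd_add (by omega), ← h1,
            chainPoint_snd_add h2.le, mul_zero, zero_add, ← Nat.cast_add,
            Nat.sub_add_cancel (by omega), ZMod.natCast_self]
        · have h3 : (i + 1) * K ≤ l * K := Nat.mul_le_mul_right K h
          rw [add_mul, one_mul] at h3
          rw [chainPoint_snd_of_le (by omega), chainPoint_snd_of_le (by omega),
            chainPoint_snd_of_le (by omega)]
          ring
    rw [key]
    exact ((chainEff_zero g).add_nsmul (by omega) _).add_chainPoint (by omega)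

theorem not_isBrillNoetherGeneral_chainGraph (hK : 0 < K) (hg : 2 * K < g) :
    ¬ IsBrillNoetherGeneral (chainGraph K g) := by
  intro h
  have hr : (1 : ℤ) ≤ rank ((K + 1 : ℕ) • chip (chainFirst K g) : Divisor (chainGraph K g)) := by
    have := natCast_le_rank_iff hK (n := 1)
      ((K + 1 : ℕ) • chip (chainFirst K g) : Divisor (chainGraph K g))
    rw [Nat.cast_one] at this
    rw [this, map_nsmul, chainClass_chip]
    exact fun w hw => chainEff_smul_sub hK hw
  -- Here `ρ(g, 1, K + 1) = 2K - g`, which is negative.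
  have h1 := h (K + 1) 1 ⟨zero_le_one, (K + 1 : ℕ) • chip (chainFirst K g), by
    rw [← natCast_zsmul, deg_zsmul, deg_chip]; push_cast; ring, hr⟩
  rw [brillNoetherNumber, genus_chainGraph] at h1
  omega

end ChainGraph

end ChipFiring

theorem mainTheorem10 :
    (∀ (α β : Type*) (G : Graph α β), IsFiniteConnectedLoopless G →
      ∀ (u v : G.vertexSet) (k : ℕ), HasGeneralTransmission u v k →
        (genus G : ℝ) / 2 + 1 ≤ (k : ℝ) → IsBrillNoetherGeneral G) ∧
    (∀ g k : ℕ, 2 ≤ k → (k : ℝ) < (g : ℝ) / 2 + 1 →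
      ∃ (G : Graph ℕ ℕ) (u v : G.vertexSet), IsFiniteConnectedLoopless G ∧ genus G = g ∧
        HasGeneralTransmission u v k ∧ ¬ IsBrillNoetherGeneral G) := by
  refine ⟨fun α β G hG u v k h hgk => ?_, fun g k hk hgk => ?_⟩
  · refine isBrillNoetherGeneral_of_hasGeneralTransmission hG u v k h ?_
    have : (genus G : ℝ) + 2 ≤ 2 * k := by linarith
    exact_mod_cast this
  -- Cycles of length `k` have `K = k - 1` path edges and one closing edge. The condition `k ≥ 2`
  -- keeps the closing edges from being loops.
  · obtain ⟨K, rfl⟩ : ∃ K, k = K + 1 := ⟨k - 1, by omega⟩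
    have hK : 0 < K := by omega
    refine ⟨chainGraph K g, chainFirst K g, chainLast K g,
      isFiniteConnectedLoopless_chainGraph hK, genus_chainGraph,
      hasGeneralTransmission_chainGraph hK, not_isBrillNoetherGeneral_chainGraph hK ?_⟩
    have : (2 : ℝ) * K < g := by push_cast at hgk; linarith
    exact_mod_cast this
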